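/- **Setting.** For a real matrix $X$ let $\sigma_i(X)$ be its $i$-th largest singular value, $\|X\|_F$ its Frobenius norm and $\|X\|_{2,\infty}$ its largest Euclidean row norm. Let $X^*\in\mathbb R^{n_1\times n_2}$ have rank $r\ge 1$, put $\sigma_r^*=\sigma_r(X^*)$, $\kappa=\sigma_1(X^*)/\sigma_r(X^*)$ and $n=\max\{n_1,n_2\}$. Let $A\in\mathbb R^{n_1\times d_1}$ and $B\in\mathbb R^{n_2\times d_2}$ satisfy $A^\top A=I$, $B^\top B=I$, $\|A\|_{2,\infty}\le\sqrt{\mu d_1/n_1}$, $\|B\|_{2,\infty}\le\sqrt{\mu d_2/n_2}$, and suppose that the columns of $X^*$ lie in the column span of $A$ and the columns of $X^{*\top}$ lie in the column span of $B$. For $\Omega\subseteq[n_1]\times[n_2]$ let $\mathcal P_\Omega(X)$ be the matrix with entries $X_{ij}$ for $(i,j)\in\Omega$ and $0$ otherwise, let $p=|\Omega|/(n_1n_2)$ and $Y=\mathcal P_\Omega(X^*)$. Let $\mathcal P_r(M)$ be a rank-$r$ truncated singular value decomposition of $M$ (any one, if it is not unique). **Proposition (initialization guarantee).** Let $c>1$,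 and let $\Omega$ be drawn uniformly at random from the subsets of $[n_1]\times[n_2]$ of a fixed size $$|\Omega|=m\ \ge\ 50\,\mu^2 d_1d_2\log n .$$ Consider iterates of $$M_0=0,\qquad M_{\tau+1}=\mathcal P_r\!\left[M_\tau-\tfrac1p A^\top\bigl(\mathcal P_\Omega(AM_\tau B^\top)-Y\bigr)B\right].$$ Then, with probability at least $1-2n^{-2}$ over $\Omega$, the following holds for every such sequence of iterates, every integer $\tau\ge 5\log(c\sqrt r\,\kappa)$ and every singular value decomposition $M_\tau=U\Sigma V^\top$ with $U\in\mathbb R^{d_1\times r}$, $V\in\mathbb R^{d_2\times r}$ with orthonormal columns and $\Sigma\in\mathbb R^{r\times r}$ diagonal with nonnegative decreasing diagonal entries: the factors $U_0=U\Sigma^{1/2}$, $V_0=V\Sigma^{1/2}$ satisfy $$\|AU_0V_0^\top B^\top-X^*\|_F\le\frac{\sigma_r^*}{c},\qquad \|U_0^\top U_0-V_0^\top V_0\|_F\le\frac{\sigma_r^*}{2c}.$$ In particular this holds for the constant $c>1$ of the recovery guarantee for GNIMC, whose initialization conditions these two inequalities are. -/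

import Mathlib

open Matrix
open scoped Matrix.Norms.Frobenius

/-- `X` has orthonormal columns (the paper's "isometry"). -/
def IsIsometryMatrix {a k : ℕ} (X : Matrix (Fin a) (Fin k) ℝ) : Prop :=
  Xᵀ * X = 1

/-- The largest Euclidean row norm `‖X‖_{2,∞}`. -/
noncomputable def maxRowNorm {a k : ℕ} (X : Matrix (Fin a) (Fin k) ℝ) : ℝ :=
  ⨆ i : Fin a, Real.sqrt (∑ j, X i j ^ 2)

/-- `μ`-incoherence of a matrix with orthonormal columns: all its row norms are at most
`√(μ d / n)`. -/
def IsIncoherent {a k : ℕ} (μ : ℝ) (X : Matrix (Fin a) (Fin k) ℝ) : Prop :=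
  maxRowNorm X ≤ Real.sqrt (μ * k / a)

/-- Side information: the columns of `X` lie in the column span of `A`, and the rows of `X` lie in
the column span of `B`. -/
def HasSideInformation {n₁ n₂ d₁ d₂ : ℕ} (X : Matrix (Fin n₁) (Fin n₂) ℝ)
    (A : Matrix (Fin n₁) (Fin d₁) ℝ) (B : Matrix (Fin n₂) (Fin d₂) ℝ) : Prop :=
  (∀ j, X.col j ∈ Submodule.span ℝ (Set.range A.col)) ∧
    (∀ i, X.row i ∈ Submodule.span ℝ (Set.range B.col))

/-- The `i`-th largest singular value of `X`, counted from `i = 1`. -/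
noncomputable def sigma {a b : ℕ} (X : Matrix (Fin a) (Fin b) ℝ) (i : ℕ) : ℝ :=
  (Matrix.toEuclideanLin X).singularValues (i - 1)

/-- The condition number `σ₁ / σ_r` of a matrix of rank `r`. -/
noncomputable def conditionNumber {a b : ℕ} (X : Matrix (Fin a) (Fin b) ℝ) : ℝ :=
  sigma X 1 / sigma X X.rank

/-- The sampling operator `P_Ω`, keeping the entries in `Ω` and setting all others to zero. -/
def sampleOp {n₁ n₂ : ℕ} (Ω : Finset (Fin n₁ × Fin n₂)) (X : Matrix (Fin n₁) (Fin n₂) ℝ) :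
    Matrix (Fin n₁) (Fin n₂) ℝ :=
  Matrix.of fun i j => if (i, j) ∈ Ω then X i j else 0

/-- The sampling rate `p = |Ω| / (n₁ n₂)`. -/
noncomputable def samplingRate {n₁ n₂ : ℕ} (Ω : Finset (Fin n₁ × Fin n₂)) : ℝ :=
  (Ω.card : ℝ) / ((n₁ : ℝ) * n₂)

/-- The uniform distribution on the observation sets with exactly `m` entries. -/
noncomputable def uniformSampling (n₁ n₂ m : ℕ) (hm : m ≤ n₁ * n₂) :
    PMF (Finset (Fin n₁ × Fin n₂)) :=
  PMF.uniformOfFinset (Finset.powersetCard m Finset.univ)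
    (Finset.powersetCard_nonempty.mpr (by simpa using hm))

/-- `W = U diag(s) Vᵀ` is a singular value decomposition with `k` singular values in decreasing
order (some of them possibly zero). -/
structure IsSVD {a b k : ℕ} (W : Matrix (Fin a) (Fin b) ℝ) (U : Matrix (Fin a) (Fin k) ℝ)
    (s : Fin k → ℝ) (V : Matrix (Fin b) (Fin k) ℝ) : Prop where
  left_orthonormal : Uᵀ * U = 1
  right_orthonormal : Vᵀ * V = 1
  nonneg : ∀ i, 0 ≤ s i
  antitone : Antitone s
  eq : W = U * diagonal s * Vᵀ

/-- `Z` is a rank-`r` truncated singular value decomposition of `W`: the `r` leading terms of some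
singular value decomposition of `W` (which one matters only if singular values coincide). -/
def IsTruncatedSVD {a b : ℕ} (r : ℕ) (W Z : Matrix (Fin a) (Fin b) ℝ) : Prop :=
  ∃ (U : Matrix (Fin a) (Fin (min a b)) ℝ) (s : Fin (min a b) → ℝ)
    (V : Matrix (Fin b) (Fin (min a b)) ℝ),
    IsSVD W U s V ∧ Z = U * diagonal (fun i : Fin (min a b) => if (i : ℕ) < r then s i else 0) * Vᵀ

/-- `M 0, M 1, …` are iterates, started at zero, of rank-`r` projected gradient descent with side
information `A`, `B`, observation set `Ω` and observed matrix `Y`. -/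
def IsProjectedGradientDescent {n₁ n₂ d₁ d₂ : ℕ} (A : Matrix (Fin n₁) (Fin d₁) ℝ)
    (B : Matrix (Fin n₂) (Fin d₂) ℝ) (Ω : Finset (Fin n₁ × Fin n₂))
    (Y : Matrix (Fin n₁) (Fin n₂) ℝ) (r : ℕ) (M : ℕ → Matrix (Fin d₁) (Fin d₂) ℝ) : Prop :=
  M 0 = 0 ∧ ∀ t, IsTruncatedSVD r
    (M t - Aᵀ * ((samplingRate Ω)⁻¹ • (sampleOp Ω (A * M t * Bᵀ) - Y)) * B) (M (t + 1))

/-- The accuracy and balance conditions on the initial factors `(U₀, V₀)`, with constant `c`, for a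
target `X` of rank `r`. The norms are Frobenius norms. -/
def InitializationConditions {n₁ n₂ d₁ d₂ r : ℕ} (c : ℝ) (X : Matrix (Fin n₁) (Fin n₂) ℝ)
    (A : Matrix (Fin n₁) (Fin d₁) ℝ) (B : Matrix (Fin n₂) (Fin d₂) ℝ)
    (U₀ : Matrix (Fin d₁) (Fin r) ℝ) (V₀ : Matrix (Fin d₂) (Fin r) ℝ) : Prop :=
  ‖A * U₀ * V₀ᵀ * Bᵀ - X‖ ≤ sigma X r / c ∧
    ‖U₀ᵀ * U₀ - V₀ᵀ * V₀‖ ≤ sigma X r / (2 * c)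

section RankOnePerturbation

variable {E : Type*} [NormedAddCommGroup E] [InnerProductSpace ℝ E]

/-- The rank-one operator `v ↦ ⟪w, v⟫ w`. -/
noncomputable def outerSelf (w : E) : E →ₗ[ℝ] E := (innerₛₗ ℝ w).smulRight w

lemma outerSelf_apply (w v : E) : outerSelf w v = inner ℝ w v • w := rfl

lemma outerSelf_isSymmetric (w : E) : (outerSelf w).IsSymmetric := fun x y => by
  simp only [outerSelf_apply, inner_smul_left, inner_smul_right, RCLike.conj_to_real]
  rw [real_inner_comm w x]
  ring

lemma sum_sq_inner_left {ι : Type*} [Fintype ι] (b : OrthonormalBasis ι ℝ E) (v : E) :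
    ∑ i, inner ℝ (b i) v ^ 2 = ‖v‖ ^ 2 := by
  have := b.sum_sq_norm_inner_right v
  simpa using this

lemma sum_inner_mul_inner' {ι : Type*} [Fintype ι] (b : OrthonormalBasis ι ℝ E) (u v : E) :
    ∑ i, inner ℝ u (b i) * inner ℝ (b i) v = inner ℝ u v := b.sum_inner_mul_inner u v

lemma isSymmetric_add_smul_outerSelf {K : E →ₗ[ℝ] E} (hK : K.IsSymmetric) (h : ℝ) (w : E) :
    (K + h • outerSelf w).IsSymmetric :=
  hK.add ((outerSelf_isSymmetric w).smul (by simp))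

variable [FiniteDimensional ℝ E]

/-- The trace of `exp K`, as a sum over the eigenvalues of the symmetric operator `K`. -/
noncomputable def expTrace {K : E →ₗ[ℝ] E} (hK : K.IsSymmetric) : ℝ :=
  ∑ i, Real.exp (hK.eigenvalues rfl i)

/-- The quadratic form `⟪w, exp K w⟫`, through an eigenbasis of the symmetric operator `K`. -/
noncomputable def expQuad {K : E →ₗ[ℝ] E} (hK : K.IsSymmetric) (w : E) : ℝ :=
  ∑ i, Real.exp (hK.eigenvalues rfl i) * inner ℝ (hK.eigenvectorBasis rfl i) w ^ 2

lemma expQuad_nonneg {K : E →ₗ[ℝ] E} (hK : K.IsSymmetric) (w : E) : 0 ≤ expQuad hK w :=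
  Finset.sum_nonneg fun _ _ => mul_nonneg (Real.exp_pos _).le (sq_nonneg _)

lemma eigenvalue_sub_mul_inner {K L : E →ₗ[ℝ] E} (hK : K.IsSymmetric) (hL : L.IsSymmetric)
    {h : ℝ} {w : E} (hKL : L = K + h • outerSelf w) (i j : Fin (Module.finrank ℝ E)) :
    (hL.eigenvalues rfl j - hK.eigenvalues rfl i) *
        inner ℝ (hL.eigenvectorBasis rfl j) (hK.eigenvectorBasis rfl i) =
      h * (inner ℝ (hL.eigenvectorBasis rfl j) w * inner ℝ (hK.eigenvectorBasis rfl i) w) := by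
  have h1 := hL (hL.eigenvectorBasis rfl j) (hK.eigenvectorBasis rfl i)
  have h2 : L (hK.eigenvectorBasis rfl i) = hK.eigenvalues rfl i • hK.eigenvectorBasis rfl i +
      h • (inner ℝ w (hK.eigenvectorBasis rfl i) • w) := by
    rw [hKL, LinearMap.add_apply, hK.apply_eigenvectorBasis]
    rfl
  rw [hL.apply_eigenvectorBasis, h2] at h1
  simp only [inner_smul_left, inner_smul_right, inner_add_right, RCLike.conj_to_real,
    RCLike.ofReal_real_eq_id, id] at h1
  rw [real_inner_comm (hK.eigenvectorBasis rfl i) w] at h1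
  linear_combination h1

lemma exp_sub_exp_mul_le (x y : ℝ) :
    (x - y) * (Real.exp x - Real.exp y) ≤ (x - y) ^ 2 * (Real.exp x + Real.exp y) / 2 := by
  have key : ∀ u : ℝ, 0 ≤ u → Real.exp u - 1 ≤ u / 2 * (Real.exp u + 1) := by
    intro u hu
    have hmono : MonotoneOn (fun u : ℝ => u / 2 * (Real.exp u + 1) - Real.exp u) (Set.Ici 0) := by
      apply monotoneOn_of_deriv_nonneg (convex_Ici 0)
      · fun_prop
      · fun_prop
      · intro z _
        have hd : HasDerivAt (fun u : ℝ => u / 2 * (Real.exp u + 1) - Real.exp u)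
            (1 / 2 * (Real.exp z + 1) + z / 2 * Real.exp z - Real.exp z) z :=
          ((((hasDerivAt_id z).div_const 2)).mul ((Real.hasDerivAt_exp z).add_const 1)).sub
            (Real.hasDerivAt_exp z)
        rw [hd.deriv]
        have h1 := Real.add_one_le_exp (-z)
        have h2 : Real.exp (-z) * Real.exp z = 1 := by rw [← Real.exp_add]; simp
        nlinarith [Real.exp_pos z]
    have := hmono (Set.mem_Ici.2 le_rfl) (Set.mem_Ici.2 hu) hu
    simp at this
    linarith
  have main : ∀ x y : ℝ, y ≤ x →
      (x - y) * (Real.exp x - Real.exp y) ≤ (x - y) ^ 2 * (Real.exp x + Real.exp y) / 2 := by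
    intro x y hxy
    have h := key (x - y) (sub_nonneg.2 hxy)
    have he : Real.exp x = Real.exp (x - y) * Real.exp y := by rw [← Real.exp_add]; simp
    rw [he]
    have h' := mul_le_mul_of_nonneg_left h (mul_nonneg (sub_nonneg.2 hxy) (Real.exp_pos y).le)
    linarith
  rcases le_total y x with h | h
  · exact main x y h
  · have := main y x h
    linarith

lemma expQuad_eq_left {K L : E →ₗ[ℝ] E} (hK : K.IsSymmetric) (hL : L.IsSymmetric) (w : E) :
    expQuad hL w = ∑ j, ∑ i, Real.exp (hL.eigenvalues rfl j) *
      (inner ℝ (hL.eigenvectorBasis rfl j) w *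
        (inner ℝ (hL.eigenvectorBasis rfl j) (hK.eigenvectorBasis rfl i) *
          inner ℝ (hK.eigenvectorBasis rfl i) w)) := by
  refine Finset.sum_congr rfl fun j _ => ?_
  rw [← Finset.mul_sum, ← Finset.mul_sum, sum_inner_mul_inner', sq]

lemma expQuad_eq_right {K L : E →ₗ[ℝ] E} (hK : K.IsSymmetric) (hL : L.IsSymmetric) (w : E) :
    expQuad hK w = ∑ j, ∑ i, Real.exp (hK.eigenvalues rfl i) *
      (inner ℝ (hL.eigenvectorBasis rfl j) w *
        (inner ℝ (hL.eigenvectorBasis rfl j) (hK.eigenvectorBasis rfl i) *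
          inner ℝ (hK.eigenvectorBasis rfl i) w)) := by
  rw [expQuad_eq_left hL hK, Finset.sum_comm]
  refine Finset.sum_congr rfl fun j _ => Finset.sum_congr rfl fun i _ => ?_
  rw [real_inner_comm (hK.eigenvectorBasis rfl i) (hL.eigenvectorBasis rfl j)]
  ring

lemma expQuad_sub_le {K L : E →ₗ[ℝ] E} (hK : K.IsSymmetric) (hL : L.IsSymmetric)
    {h : ℝ} (hh : 0 < h) {w : E} (hKL : L = K + h • outerSelf w) :
    expQuad hL w - expQuad hK w ≤ h / 2 * ‖w‖ ^ 2 * (expQuad hL w + expQuad hK w) := by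
  have hrhs : h / 2 * ‖w‖ ^ 2 * (expQuad hL w + expQuad hK w) = ∑ j, ∑ i, h / 2 *
      ((Real.exp (hL.eigenvalues rfl j) + Real.exp (hK.eigenvalues rfl i)) *
      (inner ℝ (hL.eigenvectorBasis rfl j) w ^ 2 * inner ℝ (hK.eigenvectorBasis rfl i) w ^ 2)) := by
    have e1 : ‖w‖ ^ 2 * expQuad hL w = ∑ j, ∑ i, Real.exp (hL.eigenvalues rfl j) *
      (inner ℝ (hL.eigenvectorBasis rfl j) w ^ 2 *
        inner ℝ (hK.eigenvectorBasis rfl i) w ^ 2) := by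
      rw [expQuad, Finset.mul_sum]
      refine Finset.sum_congr rfl fun j _ => ?_
      rw [← Finset.mul_sum, ← Finset.mul_sum, sum_sq_inner_left]
      ring
    have e2 : ‖w‖ ^ 2 * expQuad hK w = ∑ j, ∑ i, Real.exp (hK.eigenvalues rfl i) *
      (inner ℝ (hL.eigenvectorBasis rfl j) w ^ 2 *
        inner ℝ (hK.eigenvectorBasis rfl i) w ^ 2) := by
      rw [expQuad, Finset.mul_sum, Finset.sum_comm]
      refine Finset.sum_congr rfl fun j _ => ?_
      rw [← Finset.mul_sum, ← Finset.sum_mul, sum_sq_inner_left]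
      ring
    rw [mul_assoc, mul_add, e1, e2, ← Finset.sum_add_distrib, Finset.mul_sum]
    refine Finset.sum_congr rfl fun j _ => ?_
    rw [← Finset.sum_add_distrib, Finset.mul_sum]
    refine Finset.sum_congr rfl fun i _ => ?_
    ring
  rw [hrhs, expQuad_eq_left hK hL, expQuad_eq_right hK hL, ← Finset.sum_sub_distrib]
  refine Finset.sum_le_sum fun j _ => ?_
  rw [← Finset.sum_sub_distrib]
  refine Finset.sum_le_sum fun i _ => ?_
  have hP := eigenvalue_sub_mul_inner hK hL hKL i j
  set x := hL.eigenvalues rfl j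
  set y := hK.eigenvalues rfl i
  set P : ℝ := inner ℝ (hL.eigenvectorBasis rfl j) (hK.eigenvectorBasis rfl i)
  set α : ℝ := inner ℝ (hL.eigenvectorBasis rfl j) w
  set β : ℝ := inner ℝ (hK.eigenvectorBasis rfl i) w
  have hxy := mul_le_mul_of_nonneg_right (exp_sub_exp_mul_le x y) (sq_nonneg P)
  have e1 : (x - y) * (Real.exp x - Real.exp y) * P ^ 2
      = h * (Real.exp x * (α * (P * β)) - Real.exp y * (α * (P * β))) := by
    linear_combination (Real.exp x - Real.exp y) * P * hP
  have e2 : (x - y) ^ 2 * (Real.exp x + Real.exp y) / 2 * P ^ 2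
      = h * (h / 2 * ((Real.exp x + Real.exp y) * (α ^ 2 * β ^ 2))) := by
    linear_combination (Real.exp x + Real.exp y) / 2 * ((x - y) * P + h * (α * β)) * hP
  rw [e1, e2] at hxy
  exact le_of_mul_le_mul_left hxy hh

/-- Convexity of the trace exponential along a rank-one direction. -/
lemma expTrace_sub_le {K L : E →ₗ[ℝ] E} (hK : K.IsSymmetric) (hL : L.IsSymmetric)
    {h : ℝ} {w : E} (hKL : L = K + h • outerSelf w) :
    expTrace hL - expTrace hK ≤ h * expQuad hL w := by
  have e1 : expTrace hL = ∑ j, ∑ i, Real.exp (hL.eigenvalues rfl j) *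
      inner ℝ (hL.eigenvectorBasis rfl j) (hK.eigenvectorBasis rfl i) ^ 2 := by
    refine Finset.sum_congr rfl fun j _ => ?_
    have := sum_sq_inner_left (hK.eigenvectorBasis rfl) (hL.eigenvectorBasis rfl j)
    simp_rw [real_inner_comm (hL.eigenvectorBasis rfl j)] at this
    rw [← Finset.mul_sum, this]
    simp
  have e2 : expTrace hK = ∑ j, ∑ i, Real.exp (hK.eigenvalues rfl i) *
      inner ℝ (hL.eigenvectorBasis rfl j) (hK.eigenvectorBasis rfl i) ^ 2 := by
    rw [Finset.sum_comm]
    refine Finset.sum_congr rfl fun i _ => ?_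
    rw [← Finset.mul_sum, sum_sq_inner_left]
    simp
  rw [e1, e2, expQuad_eq_left hK hL, ← Finset.sum_sub_distrib, Finset.mul_sum]
  refine Finset.sum_le_sum fun j _ => ?_
  rw [← Finset.sum_sub_distrib, Finset.mul_sum]
  refine Finset.sum_le_sum fun i _ => ?_
  have hP := eigenvalue_sub_mul_inner hK hL hKL i j
  set x := hL.eigenvalues rfl j
  set y := hK.eigenvalues rfl i
  set P : ℝ := inner ℝ (hL.eigenvectorBasis rfl j) (hK.eigenvectorBasis rfl i)
  set α : ℝ := inner ℝ (hL.eigenvectorBasis rfl j) w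
  set β : ℝ := inner ℝ (hK.eigenvectorBasis rfl i) w
  have e : h * (Real.exp x * (α * (P * β))) = (x - y) * Real.exp x * P ^ 2 := by
    linear_combination -(Real.exp x * P) * hP
  rw [e]
  have hy : Real.exp y = Real.exp (y - x) * Real.exp x := by rw [← Real.exp_add]; simp
  have h1 := mul_le_mul_of_nonneg_right (Real.add_one_le_exp (y - x)) (Real.exp_pos x).le
  rw [← hy] at h1
  nlinarith [sq_nonneg P]

lemma expQuad_congr {K L : E →ₗ[ℝ] E} (hK : K.IsSymmetric) (hL : L.IsSymmetric) (h : K = L)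
    (w : E) : expQuad hK w = expQuad hL w := by
  subst h; rfl

lemma expTrace_congr {K L : E →ₗ[ℝ] E} (hK : K.IsSymmetric) (hL : L.IsSymmetric) (h : K = L) :
    expTrace hK = expTrace hL := by
  subst h; rfl

/-- Gronwall-type bound for `t ↦ ⟪w, exp (K + t w wᵀ) w⟫`. -/
lemma expQuad_add_le {K L : E →ₗ[ℝ] E} (hK : K.IsSymmetric) (hL : L.IsSymmetric)
    {h R : ℝ} (hh : 0 ≤ h) {w : E} (hR : ‖w‖ ^ 2 ≤ R) (hKL : L = K + h • outerSelf w) :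
    expQuad hL w ≤ Real.exp (R * h) * expQuad hK w := by
  rcases hh.eq_or_lt with rfl | hh
  · rw [expQuad_congr hL hK (by simpa using hKL)]; simp
  set c := R * h / 2 with hc
  have hc0 : 0 ≤ c := by
    have := (sq_nonneg ‖w‖).trans hR
    positivity
  have step : ∀ n : ℕ, 0 < n → c < n → ∀ k : ℕ,
      (1 - c / n) ^ k * expQuad (isSymmetric_add_smul_outerSelf hK (h * k / n) w) w ≤
        (1 + c / n) ^ k * expQuad hK w := by
    intro n hn hcn k
    have hn' : (0 : ℝ) < n := by exact_mod_cast hn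
    have h1 : 0 ≤ 1 - c / n := by rw [sub_nonneg, div_le_one hn']; exact hcn.le
    have h2 : 0 ≤ 1 + c / n := by positivity
    induction k with
    | zero => simp
    | succ k ih =>
      set a := isSymmetric_add_smul_outerSelf hK (h * k / n) w
      set b := isSymmetric_add_smul_outerSelf hK (h * (k + 1 : ℕ) / n) w
      have hs := expQuad_sub_le a b (h := h / n) (w := w) (by positivity) (by
        rw [add_assoc, ← add_smul]; congr 2; push_cast; ring)
      have hq : (1 - c / n) * expQuad b w ≤ (1 + c / n) * expQuad a w := by
        have : h / n / 2 * ‖w‖ ^ 2 * (expQuad b w + expQuad a w) ≤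
            c / n * (expQuad b w + expQuad a w) := by
          apply mul_le_mul_of_nonneg_right _ (add_nonneg (expQuad_nonneg _ _) (expQuad_nonneg _ _))
          rw [hc]
          have := mul_le_mul_of_nonneg_left hR (show 0 ≤ h / n / 2 by positivity)
          refine this.trans (le_of_eq ?_)
          ring
        linarith
      calc (1 - c / n) ^ (k + 1) * expQuad b w = (1 - c / n) ^ k * ((1 - c / n) * expQuad b w) := by
            ring
        _ ≤ (1 - c / n) ^ k * ((1 + c / n) * expQuad a w) := by gcongr
        _ = (1 + c / n) * ((1 - c / n) ^ k * expQuad a w) := by ring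
        _ ≤ (1 + c / n) * ((1 + c / n) ^ k * expQuad hK w) := by gcongr
        _ = _ := by ring
  have lim1 := (Real.tendsto_one_add_div_pow_exp (-c)).mul_const (expQuad hL w)
  have lim2 := (Real.tendsto_one_add_div_pow_exp c).mul_const (expQuad hK w)
  have hle : Real.exp (-c) * expQuad hL w ≤ Real.exp c * expQuad hK w := by
    refine le_of_tendsto_of_tendsto lim1 lim2 ?_
    filter_upwards [Filter.eventually_gt_atTop 0,
      tendsto_natCast_atTop_atTop.eventually_gt_atTop c] with n hn hcn
    have := step n hn hcn n
    rw [expQuad_congr (isSymmetric_add_smul_outerSelf hK (h * n / n) w) hL (by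
      rw [hKL, mul_div_cancel_right₀]; exact_mod_cast hn.ne')] at this
    rwa [neg_div, ← sub_eq_add_neg]
  calc expQuad hL w = Real.exp c * (Real.exp (-c) * expQuad hL w) := by
        rw [← mul_assoc, ← Real.exp_add]; simp
    _ ≤ Real.exp c * (Real.exp c * expQuad hK w) := by gcongr
    _ = _ := by rw [← mul_assoc, ← Real.exp_add, hc]; ring_nf

lemma mul_expQuad_add_le {K L : E →ₗ[ℝ] E} (hK : K.IsSymmetric) (hL : L.IsSymmetric)
    {h R : ℝ} {w : E} (hR : ‖w‖ ^ 2 ≤ R) (hKL : L = K + h • outerSelf w) :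
    h * expQuad hL w ≤ h * (Real.exp (R * h) * expQuad hK w) := by
  rcases le_total 0 h with hh | hh
  · exact mul_le_mul_of_nonneg_left (expQuad_add_le hK hL hh hR hKL) hh
  · apply mul_le_mul_of_nonpos_left _ hh
    have := expQuad_add_le hL hK (neg_nonneg.2 hh) hR (by rw [hKL]; simp)
    calc Real.exp (R * h) * expQuad hK w
        ≤ Real.exp (R * h) * (Real.exp (R * -h) * expQuad hL w) := by gcongr
      _ = _ := by rw [← mul_assoc, ← Real.exp_add]; simp

lemma tendsto_exp_mul_div_sub_one {c : ℝ} (hc : c ≠ 0) :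
    Filter.Tendsto (fun n : ℕ => c / n * Real.exp (c / n) / (Real.exp (c / n) - 1))
      Filter.atTop (nhds 1) := by
  have h1 : Filter.Tendsto (fun n : ℕ => c / (n : ℝ)) Filter.atTop (nhdsWithin 0 {0}ᶜ) := by
    rw [tendsto_nhdsWithin_iff]
    refine ⟨tendsto_const_div_atTop_nhds_zero_nat c, ?_⟩
    filter_upwards [Filter.eventually_gt_atTop 0] with n hn
    have : (n : ℝ) ≠ 0 := by exact_mod_cast hn.ne'
    simp [hc, this]
  have h2 := (hasDerivAt_iff_tendsto_slope.1 (Real.hasDerivAt_exp 0)).comp h1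
  have h3 := (Real.continuous_exp.tendsto 0).comp (tendsto_nhds_of_tendsto_nhdsWithin h1)
  have h4 := h3.div h2 (by simp)
  simp only [Real.exp_zero, div_one] at h4
  refine h4.congr fun n => ?_
  simp only [Pi.div_apply, Function.comp, slope_def_field, Real.exp_zero, sub_zero]
  rw [div_div_eq_mul_div, mul_comm]

/-- Golden–Thompson inequality for a rank-one increment. -/
lemma expTrace_add_le {K L : E →ₗ[ℝ] E} (hK : K.IsSymmetric) (hL : L.IsSymmetric)
    {h R : ℝ} {w : E} (hR0 : 0 < R) (hR : ‖w‖ ^ 2 ≤ R) (hKL : L = K + h • outerSelf w) :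
    expTrace hL ≤ expTrace hK + (Real.exp (R * h) - 1) / R * expQuad hK w := by
  rcases eq_or_ne h 0 with rfl | hh
  · rw [expTrace_congr hL hK (by simpa using hKL)]; simp
  have hc : R * h ≠ 0 := mul_ne_zero hR0.ne' hh
  have step : ∀ n : ℕ, 0 < n → ∀ k : ℕ,
      expTrace (isSymmetric_add_smul_outerSelf hK (h * k / n) w) ≤
        expTrace hK + h / n * (∑ l ∈ Finset.range k, Real.exp (R * h / n) ^ (l + 1)) *
          expQuad hK w := by
    intro n hn k
    have hn' : (0 : ℝ) < n := by exact_mod_cast hn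
    induction k with
    | zero => simp
    | succ k ih =>
      set a := isSymmetric_add_smul_outerSelf hK (h * k / n) w
      set b := isSymmetric_add_smul_outerSelf hK (h * (k + 1 : ℕ) / n) w
      have hs := expTrace_sub_le a b (h := h / n) (w := w) (by
        rw [add_assoc, ← add_smul]; congr 2; push_cast; ring)
      have hq := mul_expQuad_add_le hK b hR rfl
      have hpos : (0 : ℝ) < 1 / (k + 1 : ℕ) := by positivity
      have hq' := mul_le_mul_of_nonneg_left hq hpos.le
      have e : Real.exp (R * (h * (k + 1 : ℕ) / n)) = Real.exp (R * h / n) ^ (k + 1) := by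
        rw [← Real.exp_nat_mul]; congr 1; ring
      have hk : ((k + 1 : ℕ) : ℝ) ≠ 0 := by positivity
      have e2 : ∀ z : ℝ, 1 / ((k + 1 : ℕ) : ℝ) * (h * (k + 1 : ℕ) / n * z) = h / n * z := by
        intro z; field_simp
      rw [e, e2, e2] at hq'
      rw [Finset.sum_range_succ]
      linarith
  have lim := ((tendsto_exp_mul_div_sub_one hc).mul_const
    ((Real.exp (R * h) - 1) / R * expQuad hK w)).const_add (expTrace hK)
  rw [one_mul] at lim
  refine ge_of_tendsto lim ?_
  filter_upwards [Filter.eventually_gt_atTop 0] with n hn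
  have hn' : (n : ℝ) ≠ 0 := by exact_mod_cast hn.ne'
  have := step n hn n
  rw [expTrace_congr (isSymmetric_add_smul_outerSelf hK (h * n / n) w) hL (by
      rw [hKL, mul_div_cancel_right₀ _ hn'])] at this
  refine this.trans (le_of_eq ?_)
  have hz : Real.exp (R * h / n) ≠ 1 := by
    rw [Ne, Real.exp_eq_one_iff]
    exact div_ne_zero hc hn'
  have hz' : Real.exp (R * h / n) - 1 ≠ 0 := sub_ne_zero.2 hz
  simp_rw [pow_succ]
  rw [← Finset.sum_mul, geom_sum_eq hz, ← Real.exp_nat_mul, mul_div_cancel₀ _ hn']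
  field_simp

end RankOnePerturbation

section SymmetricOperators

variable {E : Type*} [NormedAddCommGroup E] [InnerProductSpace ℝ E] [FiniteDimensional ℝ E]

lemma eigenvalues_eq_inner {K : E →ₗ[ℝ] E} (hK : K.IsSymmetric) (i : Fin (Module.finrank ℝ E)) :
    hK.eigenvalues rfl i =
      inner ℝ (hK.eigenvectorBasis rfl i) (K (hK.eigenvectorBasis rfl i)) := by
  rw [hK.apply_eigenvectorBasis, inner_smul_right]
  simp

lemma inner_apply_self_eq_sum {K : E →ₗ[ℝ] E} (hK : K.IsSymmetric) (v : E) :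
    inner ℝ v (K v) =
      ∑ i, hK.eigenvalues rfl i * inner ℝ (hK.eigenvectorBasis rfl i) v ^ 2 := by
  rw [← sum_inner_mul_inner' (hK.eigenvectorBasis rfl)]
  refine Finset.sum_congr rfl fun i _ => ?_
  rw [← hK (hK.eigenvectorBasis rfl i) v, hK.apply_eigenvectorBasis, inner_smul_left,
    real_inner_comm (hK.eigenvectorBasis rfl i) v]
  simp
  ring

lemma norm_apply_le_of_abs_inner_le {K : E →ₗ[ℝ] E} (hK : K.IsSymmetric) {δ : ℝ} (hδ : 0 ≤ δ)
    (h : ∀ v, |inner ℝ v (K v)| ≤ δ * ‖v‖ ^ 2) (v : E) : ‖K v‖ ≤ δ * ‖v‖ := by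
  rw [← sq_le_sq₀ (norm_nonneg _) (by positivity), mul_pow,
    ← sum_sq_inner_left (hK.eigenvectorBasis rfl) (K v),
    ← sum_sq_inner_left (hK.eigenvectorBasis rfl) v, Finset.mul_sum]
  refine Finset.sum_le_sum fun i _ => ?_
  have hi := h (hK.eigenvectorBasis rfl i)
  rw [← eigenvalues_eq_inner] at hi
  simp only [OrthonormalBasis.norm_eq_one, one_pow, mul_one] at hi
  rw [← hK (hK.eigenvectorBasis rfl i) v, hK.apply_eigenvectorBasis, inner_smul_left, mul_pow]
  refine mul_le_mul_of_nonneg_right ?_ (sq_nonneg _)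
  simpa using sq_le_sq' (abs_le.1 hi).1 (abs_le.1 hi).2

end SymmetricOperators

section DoubleCounting

variable {κ : Type*} [Fintype κ] [DecidableEq κ]

lemma sum_powersetCard_sum_insert (f : Finset κ → ℝ) (k : ℕ) :
    ∑ T ∈ Finset.powersetCard k (Finset.univ : Finset κ), ∑ e ∈ Tᶜ, f (insert e T) =
      (k + 1) * ∑ S ∈ Finset.powersetCard (k + 1) (Finset.univ : Finset κ), f S := by
  have h : ∑ S ∈ Finset.powersetCard (k + 1) (Finset.univ : Finset κ), ∑ _e ∈ S, f S =
      (k + 1) * ∑ S ∈ Finset.powersetCard (k + 1) (Finset.univ : Finset κ), f S := by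
    rw [Finset.mul_sum]
    refine Finset.sum_congr rfl fun S hS => ?_
    rw [Finset.sum_const, (Finset.mem_powersetCard.1 hS).2, nsmul_eq_mul]
    push_cast
    ring
  rw [← h, Finset.sum_sigma', Finset.sum_sigma']
  refine Finset.sum_bij' (fun x _ => ⟨insert x.2 x.1, x.2⟩) (fun x _ => ⟨x.1.erase x.2, x.2⟩)
    ?_ ?_ ?_ ?_ ?_
  · rintro ⟨T, e⟩ hx
    simp only [Finset.mem_sigma, Finset.mem_powersetCard, Finset.mem_compl] at hx ⊢
    exact ⟨⟨Finset.subset_univ _, by rw [Finset.card_insert_of_notMem hx.2, hx.1.2]⟩,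
      Finset.mem_insert_self _ _⟩
  · rintro ⟨S, e⟩ hx
    simp only [Finset.mem_sigma, Finset.mem_powersetCard, Finset.mem_compl] at hx ⊢
    exact ⟨⟨Finset.subset_univ _, by rw [Finset.card_erase_of_mem hx.2, hx.1.2]; rfl⟩,
      Finset.notMem_erase _ _⟩
  · rintro ⟨T, e⟩ hx
    simp only [Finset.mem_sigma, Finset.mem_compl] at hx
    simp [Finset.erase_insert hx.2]
  · rintro ⟨S, e⟩ hx
    simp only [Finset.mem_sigma] at hx
    simp [Finset.insert_erase hx.2]
  · rintro ⟨T, e⟩ _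
    rfl

lemma card_mul_sum_powersetCard_sum (g : κ → ℝ) (k : ℕ) :
    (Fintype.card κ : ℝ) *
        ∑ T ∈ Finset.powersetCard k (Finset.univ : Finset κ), ∑ e ∈ T, g e =
      k * (Fintype.card κ).choose k * ∑ e, g e := by
  induction k with
  | zero => simp
  | succ k ih =>
    have h := sum_powersetCard_sum_insert (fun T => ∑ e ∈ T, g e) k
    have h2 : ∀ T ∈ Finset.powersetCard k (Finset.univ : Finset κ),
        ∑ e ∈ Tᶜ, ∑ e' ∈ insert e T, g e' =
          ((Fintype.card κ : ℝ) - k - 1) * ∑ e ∈ T, g e + ∑ e, g e := by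
      intro T hT
      have hc : (Tᶜ.card : ℝ) = Fintype.card κ - k := by
        rw [Finset.card_compl, Nat.cast_sub (Finset.card_le_univ T),
          (Finset.mem_powersetCard.1 hT).2]
      have h3 : ∑ e ∈ Tᶜ, ∑ e' ∈ insert e T, g e' = ∑ e ∈ Tᶜ, (g e + ∑ e' ∈ T, g e') :=
        Finset.sum_congr rfl fun e he => Finset.sum_insert (Finset.mem_compl.1 he)
      rw [h3, Finset.sum_add_distrib, Finset.sum_const, nsmul_eq_mul, hc,
        ← Finset.sum_add_sum_compl T g]
      ring
    rw [Finset.sum_congr rfl h2, Finset.sum_add_distrib, ← Finset.mul_sum, Finset.sum_const,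
      Finset.card_powersetCard, Finset.card_univ, nsmul_eq_mul] at h
    have hch : ((Fintype.card κ).choose (k + 1) : ℝ) * (k + 1) =
        (Fintype.card κ).choose k * ((Fintype.card κ : ℝ) - k) := by
      rcases le_or_gt k (Fintype.card κ) with hk | hk
      · have := Nat.choose_succ_right_eq (Fintype.card κ) k
        rw [← Nat.cast_sub hk]
        exact_mod_cast this
      · rw [Nat.choose_eq_zero_of_lt hk, Nat.choose_eq_zero_of_lt (by omega)]
        simp
    have hk1 : ((k : ℝ) + 1) ≠ 0 := by positivity
    apply mul_left_cancel₀ hk1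
    push_cast
    linear_combination -(Fintype.card κ : ℝ) * h + ((Fintype.card κ : ℝ) - k - 1) * ih
      - (∑ e, g e) * (k + 1) * hch

end DoubleCounting

section Sampling

variable {E : Type*} [NormedAddCommGroup E] [InnerProductSpace ℝ E]
  {κ : Type*}

/-- The operator `∑ w wᵀ` over a set of sampled vectors `w`. -/
noncomputable def sampledOp (w : κ → E) (T : Finset κ) : E →ₗ[ℝ] E := ∑ e ∈ T, outerSelf (w e)

lemma sampledOp_apply (w : κ → E) (T : Finset κ) (v : E) :
    sampledOp w T v = ∑ e ∈ T, inner ℝ (w e) v • w e := by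
  simp [sampledOp, outerSelf_apply]

lemma inner_sampledOp (w : κ → E) (T : Finset κ) (v : E) :
    inner ℝ v (sampledOp w T v) = ∑ e ∈ T, inner ℝ (w e) v ^ 2 := by
  rw [sampledOp_apply, inner_sum]
  refine Finset.sum_congr rfl fun e _ => ?_
  rw [inner_smul_right, real_inner_comm, sq]

lemma sampledOp_isSymmetric (w : κ → E) (T : Finset κ) : (sampledOp w T).IsSymmetric := by
  classical
  induction T using Finset.induction_on with
  | empty => intro x y; simp [sampledOp]
  | insert e T he ih =>
    rw [sampledOp, Finset.sum_insert he]
    exact (outerSelf_isSymmetric _).add ih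

lemma smul_sampledOp_isSymmetric (θ : ℝ) (w : κ → E) (T : Finset κ) :
    (θ • sampledOp w T).IsSymmetric := (sampledOp_isSymmetric w T).smul (by simp)

variable [FiniteDimensional ℝ E]

lemma eigenvalues_smul_sampledOp (θ : ℝ) (w : κ → E) (T : Finset κ)
    (i : Fin (Module.finrank ℝ E)) :
    (smul_sampledOp_isSymmetric θ w T).eigenvalues rfl i =
      θ * ∑ e ∈ T, inner ℝ (w e)
        ((smul_sampledOp_isSymmetric θ w T).eigenvectorBasis rfl i) ^ 2 := by
  rw [eigenvalues_eq_inner, LinearMap.smul_apply, inner_smul_right, inner_sampledOp]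

variable [Fintype κ]

lemma sum_norm_sq_eq_finrank {w : κ → E} (hw : ∀ v, ∑ e, inner ℝ (w e) v ^ 2 = ‖v‖ ^ 2) :
    ∑ e, ‖w e‖ ^ 2 = Module.finrank ℝ E := by
  have h : ∀ e, ‖w e‖ ^ 2 = ∑ i, inner ℝ (w e) (stdOrthonormalBasis ℝ E i) ^ 2 := by
    intro e
    rw [← sum_sq_inner_left (stdOrthonormalBasis ℝ E)]
    simp_rw [real_inner_comm]
  simp_rw [h]
  rw [Finset.sum_comm]
  simp [hw]

lemma mul_cov_nonneg {θ a : ℝ} (h : 0 ≤ θ ∧ 0 ≤ a ∨ θ ≤ 0 ∧ a ≤ 0) (x t : ℝ) :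
    0 ≤ a * ((x - t) * (Real.exp (θ * x) - Real.exp (θ * t))) := by
  rcases h with ⟨hθ, ha⟩ | ⟨hθ, ha⟩ <;> rcases le_total x t with hx | hx
  · exact mul_nonneg ha (mul_nonneg_of_nonpos_of_nonpos (sub_nonpos.2 hx)
      (sub_nonpos.2 (Real.exp_le_exp.2 (mul_le_mul_of_nonneg_left hx hθ))))
  · exact mul_nonneg ha (mul_nonneg (sub_nonneg.2 hx)
      (sub_nonneg.2 (Real.exp_le_exp.2 (mul_le_mul_of_nonneg_left hx hθ))))
  · exact mul_nonneg_of_nonpos_of_nonpos ha (mul_nonpos_of_nonpos_of_nonneg (sub_nonpos.2 hx)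
      (sub_nonneg.2 (Real.exp_le_exp.2 (mul_le_mul_of_nonpos_left hx hθ))))
  · exact mul_nonneg_of_nonpos_of_nonpos ha (mul_nonpos_of_nonneg_of_nonpos (sub_nonneg.2 hx)
      (sub_nonpos.2 (Real.exp_le_exp.2 (mul_le_mul_of_nonpos_left hx hθ))))

variable [DecidableEq κ]

/-- One more uniformly chosen element multiplies the exponential moment by at most `1 + a / N`,
summed over the outcomes. -/
lemma sum_expTrace_succ_le {w : κ → E} (hw : ∀ v, ∑ e, inner ℝ (w e) v ^ 2 = ‖v‖ ^ 2)
    {R : ℝ} (hR0 : 0 < R) (hR : ∀ e, ‖w e‖ ^ 2 ≤ R) (hN : 0 < Fintype.card κ) (θ : ℝ) (k : ℕ) :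
    (k + 1) * ∑ T ∈ Finset.powersetCard (k + 1) (Finset.univ : Finset κ),
        expTrace (smul_sampledOp_isSymmetric θ w T) ≤
      ((Fintype.card κ : ℝ) - k) * (1 + (Real.exp (R * θ) - 1) / R / Fintype.card κ) *
        ∑ T ∈ Finset.powersetCard k (Finset.univ : Finset κ),
          expTrace (smul_sampledOp_isSymmetric θ w T) := by
  set N : ℝ := ((Fintype.card κ : ℕ) : ℝ) with hNdef
  have hN' : 0 < N := by rw [hNdef]; exact_mod_cast hN
  set a := (Real.exp (R * θ) - 1) / R with ha
  have hsign : 0 ≤ θ ∧ 0 ≤ a ∨ θ ≤ 0 ∧ a ≤ 0 := by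
    rcases le_total 0 θ with h | h
    · left
      exact ⟨h, div_nonneg (sub_nonneg.2 (Real.one_le_exp (by positivity))) hR0.le⟩
    · right
      exact ⟨h, div_nonpos_of_nonpos_of_nonneg
        (sub_nonpos.2 (Real.exp_le_one_iff.2 (mul_nonpos_of_nonneg_of_nonpos hR0.le h))) hR0.le⟩
  let lam : Finset κ → Fin (Module.finrank ℝ E) → ℝ := fun T i =>
    ∑ e ∈ T, inner ℝ (w e) ((smul_sampledOp_isSymmetric θ w T).eigenvectorBasis rfl i) ^ 2
  have hlam : ∀ T, expTrace (smul_sampledOp_isSymmetric θ w T) =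
      ∑ i, Real.exp (θ * lam T i) := fun T =>
    Finset.sum_congr rfl fun i _ => by rw [eigenvalues_smul_sampledOp]
  have h1 : ∀ T ∈ Finset.powersetCard k (Finset.univ : Finset κ),
      ∑ e ∈ Tᶜ, expTrace (smul_sampledOp_isSymmetric θ w (insert e T)) ≤
        (N - k) * expTrace (smul_sampledOp_isSymmetric θ w T) +
          a * ∑ i, Real.exp (θ * lam T i) * (1 - lam T i) := by
    intro T hT
    have hc : (Tᶜ.card : ℝ) = N - k := by
      rw [Finset.card_compl, Nat.cast_sub (Finset.card_le_univ T),
        (Finset.mem_powersetCard.1 hT).2]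
    have hstep : ∀ e ∈ Tᶜ, expTrace (smul_sampledOp_isSymmetric θ w (insert e T)) ≤
        expTrace (smul_sampledOp_isSymmetric θ w T) +
          a * expQuad (smul_sampledOp_isSymmetric θ w T) (w e) := by
      intro e he
      refine expTrace_add_le _ _ hR0 (hR e) ?_
      rw [sampledOp, Finset.sum_insert (Finset.mem_compl.1 he), smul_add, add_comm]
      rfl
    refine (Finset.sum_le_sum hstep).trans (le_of_eq ?_)
    rw [Finset.sum_add_distrib, Finset.sum_const, nsmul_eq_mul, hc, ← Finset.mul_sum]
    congr 2
    unfold expQuad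
    rw [Finset.sum_comm]
    refine Finset.sum_congr rfl fun i _ => ?_
    rw [← Finset.mul_sum, eigenvalues_smul_sampledOp]
    congr 1
    have := hw ((smul_sampledOp_isSymmetric θ w T).eigenvectorBasis rfl i)
    rw [← Finset.sum_add_sum_compl T, OrthonormalBasis.norm_eq_one] at this
    simp_rw [real_inner_comm (w _)]
    simp only [lam]
    linarith
  rw [← sum_powersetCard_sum_insert]
  refine (Finset.sum_le_sum h1).trans ?_
  rw [Finset.sum_add_distrib, ← Finset.mul_sum, ← Finset.mul_sum]
  set P := Finset.powersetCard k (Finset.univ : Finset κ) with hP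
  set t : ℝ := k / N with ht
  have hmean : ∑ T ∈ P, ∑ i, (lam T i - t) = 0 := by
    have e1 : ∀ T, ∑ i, lam T i = ∑ e ∈ T, ‖w e‖ ^ 2 := by
      intro T
      simp only [lam]
      rw [Finset.sum_comm]
      refine Finset.sum_congr rfl fun e _ => ?_
      rw [← sum_sq_inner_left ((smul_sampledOp_isSymmetric θ w T).eigenvectorBasis rfl)]
      simp_rw [real_inner_comm]
    have e2 := card_mul_sum_powersetCard_sum (fun e => ‖w e‖ ^ 2) k
    rw [sum_norm_sq_eq_finrank hw] at e2
    simp_rw [Finset.sum_sub_distrib, e1, Finset.sum_const, nsmul_eq_mul]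
    rw [hP, Finset.card_powersetCard, Finset.card_univ, Finset.card_univ, Fintype.card_fin, ht]
    apply mul_left_cancel₀ hN'.ne'
    rw [mul_sub, hNdef, e2]
    field_simp
    ring
  have hcov : 0 ≤ ∑ T ∈ P, ∑ i,
      a * ((lam T i - t) * (Real.exp (θ * lam T i) - Real.exp (θ * t))) :=
    Finset.sum_nonneg fun T _ => Finset.sum_nonneg fun i _ => mul_cov_nonneg hsign _ _
  have hsplit : ∑ T ∈ P, ∑ i,
      a * ((lam T i - t) * (Real.exp (θ * lam T i) - Real.exp (θ * t))) =
      a * ((1 - t) * ∑ T ∈ P, expTrace (smul_sampledOp_isSymmetric θ w T) -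
        ∑ T ∈ P, ∑ i, Real.exp (θ * lam T i) * (1 - lam T i)) -
      a * Real.exp (θ * t) * ∑ T ∈ P, ∑ i, (lam T i - t) := by
    simp_rw [hlam]
    simp only [Finset.mul_sum, mul_sub, ← Finset.sum_sub_distrib]
    refine Finset.sum_congr rfl fun T _ => Finset.sum_congr rfl fun i _ => ?_
    ring
  rw [hsplit, hmean, mul_zero, sub_zero] at hcov
  have e3 : (N - k) * (1 + a / N) = (N - k) + a * (1 - t) := by
    rw [ht]; field_simp
  rw [e3]
  linarith

lemma sum_expTrace_le {w : κ → E} (hw : ∀ v, ∑ e, inner ℝ (w e) v ^ 2 = ‖v‖ ^ 2)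
    {R : ℝ} (hR0 : 0 < R) (hR : ∀ e, ‖w e‖ ^ 2 ≤ R) (hN : 0 < Fintype.card κ) (θ : ℝ) (k : ℕ)
    (hk : k ≤ Fintype.card κ) :
    ∑ T ∈ Finset.powersetCard k (Finset.univ : Finset κ),
        expTrace (smul_sampledOp_isSymmetric θ w T) ≤
      (Fintype.card κ).choose k * Module.finrank ℝ E *
        Real.exp (k * ((Real.exp (R * θ) - 1) / R / Fintype.card κ)) := by
  induction k with
  | zero =>
    have h0 : ∀ i, (smul_sampledOp_isSymmetric θ w ∅).eigenvalues rfl i = 0 := fun i => by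
      rw [eigenvalues_smul_sampledOp]; simp
    simp [expTrace, h0]
  | succ k ih =>
    have ih := ih (by omega)
    have h := sum_expTrace_succ_le hw hR0 hR hN θ k
    set b := (Real.exp (R * θ) - 1) / R / Fintype.card κ
    set F := ∑ T ∈ Finset.powersetCard k (Finset.univ : Finset κ),
      expTrace (smul_sampledOp_isSymmetric θ w T)
    have hF : 0 ≤ F := Finset.sum_nonneg fun T _ => Finset.sum_nonneg fun i _ =>
      (Real.exp_pos _).le
    have hkN : (0 : ℝ) ≤ Fintype.card κ - k := by
      rw [sub_nonneg]; exact_mod_cast (by omega : k ≤ Fintype.card κ)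
    have hch : ((Fintype.card κ).choose (k + 1) : ℝ) * (k + 1) =
        (Fintype.card κ).choose k * ((Fintype.card κ : ℝ) - k) := by
      rw [← Nat.cast_sub (by omega : k ≤ Fintype.card κ)]
      exact_mod_cast Nat.choose_succ_right_eq (Fintype.card κ) k
    have hk1 : (0 : ℝ) < k + 1 := by positivity
    refine le_of_mul_le_mul_left (h.trans ?_) hk1
    calc ((Fintype.card κ : ℝ) - k) * (1 + b) * F
        ≤ ((Fintype.card κ : ℝ) - k) * Real.exp b * F := by
          gcongr
          linarith [Real.add_one_le_exp b]
      _ ≤ ((Fintype.card κ : ℝ) - k) * Real.exp b *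
          ((Fintype.card κ).choose k * Module.finrank ℝ E * Real.exp (k * b)) := by
          gcongr
      _ = ((Fintype.card κ).choose k * ((Fintype.card κ : ℝ) - k)) * Module.finrank ℝ E *
          (Real.exp (k * b) * Real.exp b) := by ring
      _ = _ := by
          rw [← hch, ← Real.exp_add]
          push_cast
          ring_nf

/-- Matrix Chernoff bound for sampling without replacement, for either tail. -/
lemma card_tail_mul_exp_le {w : κ → E} (hw : ∀ v, ∑ e, inner ℝ (w e) v ^ 2 = ‖v‖ ^ 2)
    {R : ℝ} (hR0 : 0 < R) (hR : ∀ e, ‖w e‖ ^ 2 ≤ R) (hN : 0 < Fintype.card κ) (θ s : ℝ) (k : ℕ)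
    (hk : k ≤ Fintype.card κ) (B : Finset (Finset κ))
    (hB : B ⊆ Finset.powersetCard k (Finset.univ : Finset κ))
    (hBs : ∀ T ∈ B, ∃ v : E, θ * s * ‖v‖ ^ 2 < θ * inner ℝ v (sampledOp w T v)) :
    (B.card : ℝ) * Real.exp (θ * s) ≤ (Fintype.card κ).choose k * Module.finrank ℝ E *
        Real.exp (k * ((Real.exp (R * θ) - 1) / R / Fintype.card κ)) := by
  refine le_trans ?_ (sum_expTrace_le hw hR0 hR hN θ k hk)
  have hle : ∀ T ∈ B, Real.exp (θ * s) ≤ expTrace (smul_sampledOp_isSymmetric θ w T) := by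
    intro T hT
    obtain ⟨v, hv⟩ := hBs T hT
    have h1 := inner_apply_self_eq_sum (smul_sampledOp_isSymmetric θ w T) v
    rw [LinearMap.smul_apply, inner_smul_right] at h1
    rw [h1, ← sum_sq_inner_left ((smul_sampledOp_isSymmetric θ w T).eigenvectorBasis rfl) v,
      Finset.mul_sum] at hv
    obtain ⟨i, _, hi⟩ := Finset.exists_lt_of_sum_lt hv
    have hi' : θ * s ≤ (smul_sampledOp_isSymmetric θ w T).eigenvalues rfl i :=
      (lt_of_mul_lt_mul_right hi (sq_nonneg _)).le
    exact (Real.exp_le_exp.2 hi').trans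
      (Finset.single_le_sum (f := fun i => Real.exp
        ((smul_sampledOp_isSymmetric θ w T).eigenvalues rfl i))
        (fun i _ => (Real.exp_pos _).le) (Finset.mem_univ i))
  calc (B.card : ℝ) * Real.exp (θ * s) = ∑ T ∈ B, Real.exp (θ * s) := by simp
    _ ≤ ∑ T ∈ B, expTrace (smul_sampledOp_isSymmetric θ w T) := Finset.sum_le_sum hle
    _ ≤ _ := Finset.sum_le_sum_of_subset_of_nonneg hB fun T _ _ =>
        Finset.sum_nonneg fun i _ => (Real.exp_pos _).le

end Sampling

section Sampling

variable {E : Type*} [NormedAddCommGroup E] [InnerProductSpace ℝ E] [FiniteDimensional ℝ E]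
  {κ : Type*} [Fintype κ]

lemma exp_two_fifths_le : Real.exp (2 / 5) ≤ 1.52 := by
  have h : Real.exp (2 / 5) ^ 5 ≤ 1.52 ^ 5 := by
    rw [← Real.exp_nat_mul]
    have e : Real.exp ((5 : ℕ) * (2 / 5)) = Real.exp 1 ^ 2 := by
      rw [← Real.exp_nat_mul]; norm_num
    rw [e]
    have := Real.exp_one_lt_d9
    have h0 := Real.exp_pos 1
    nlinarith
  exact le_of_pow_le_pow_left₀ (by norm_num) (by norm_num) h

lemma exp_neg_half_le : Real.exp (-(1 / 2)) ≤ 0.67 := by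
  have h1 := Real.add_one_le_exp (1 / 2 : ℝ)
  have h2 : Real.exp (-(1 / 2)) * Real.exp (1 / 2) = 1 := by rw [← Real.exp_add]; simp
  nlinarith [Real.exp_pos (-(1 / 2) : ℝ)]

lemma le_mul_exp_of_mul_exp_le {b c x y z : ℝ} (h : b * Real.exp x ≤ c * Real.exp y) (hc : 0 ≤ c)
    (hz : y - x ≤ z) : b ≤ c * Real.exp z := by
  have h1 := mul_le_mul_of_nonneg_right h (Real.exp_pos (-x)).le
  rw [mul_assoc, mul_assoc, ← Real.exp_add, ← Real.exp_add, add_neg_cancel, Real.exp_zero, mul_one,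
    ← sub_eq_add_neg] at h1
  exact h1.trans (by gcongr)

/-- With `m ≥ 50 N R ℓ` uniformly sampled vectors of a tight frame, the rescaled frame operator is
within `1/2` of the identity, except for a fraction `2 D exp (-4 ℓ)` of the samples. -/
lemma card_not_near_identity_le {w : κ → E} (hw : ∀ v, ∑ e, inner ℝ (w e) v ^ 2 = ‖v‖ ^ 2)
    {R l : ℝ} (hR0 : 0 < R) (hR : ∀ e, ‖w e‖ ^ 2 ≤ R) (hN : 0 < Fintype.card κ) (m : ℕ)
    (hm0 : 0 < m) (hm : m ≤ Fintype.card κ) (hml : 50 * R * Fintype.card κ * l ≤ m)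
    (B : Finset (Finset κ)) (hB : B ⊆ Finset.powersetCard m (Finset.univ : Finset κ))
    (hbad : ∀ T ∈ B, ∃ v, 1 / 2 * ‖v‖ <
      ‖((m : ℝ) / Fintype.card κ)⁻¹ • sampledOp w T v - v‖) :
    (B.card : ℝ) ≤
      2 * ((Fintype.card κ).choose m * Module.finrank ℝ E * Real.exp (-(4 * l))) := by
  classical
  set N : ℝ := ((Fintype.card κ : ℕ) : ℝ) with hNdef
  have hN' : 0 < N := by rw [hNdef]; exact_mod_cast hN
  have hm' : (0 : ℝ) < m := by exact_mod_cast hm0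
  set p : ℝ := m / N with hp
  have hp0 : 0 < p := by positivity
  have hc : (0 : ℝ) ≤ (Fintype.card κ).choose m * Module.finrank ℝ E := by positivity
  have hq : 50 * l ≤ p / R := by
    rw [hp, le_div_iff₀ hR0, le_div_iff₀ hN']
    linarith
  let B₁ := B.filter fun T => ∃ v, 2 / 5 / R * (3 / 2 * p) * ‖v‖ ^ 2 <
    2 / 5 / R * inner ℝ v (sampledOp w T v)
  let B₂ := B.filter fun T => ∃ v, -(1 / 2) / R * (1 / 2 * p) * ‖v‖ ^ 2 <
    -(1 / 2) / R * inner ℝ v (sampledOp w T v)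
  have hcover : B ⊆ B₁ ∪ B₂ := by
    intro T hT
    by_contra hcon
    simp only [B₁, B₂, Finset.mem_union, Finset.mem_filter, hT, true_and, not_or, not_exists,
      not_lt] at hcon
    obtain ⟨v, hv⟩ := hbad T hT
    have hsym : (p⁻¹ • sampledOp w T - LinearMap.id : E →ₗ[ℝ] E).IsSymmetric :=
      (smul_sampledOp_isSymmetric _ w T).sub (fun _ _ => rfl)
    refine absurd (norm_apply_le_of_abs_inner_le hsym (δ := 1 / 2) (by norm_num) ?_ v)
      (not_le.2 hv)
    intro u
    have h1 := hcon.1 u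
    have h2 := hcon.2 u
    rw [mul_assoc] at h1 h2
    have h1' := le_of_mul_le_mul_left h1 (by positivity)
    have hneg : -(1 / 2) / R < 0 := by rw [neg_div]; exact neg_neg_of_pos (by positivity)
    have h2' := (mul_le_mul_left_of_neg hneg).1 h2
    have e : inner ℝ u ((p⁻¹ • sampledOp w T - LinearMap.id : E →ₗ[ℝ] E) u) =
        p⁻¹ * inner ℝ u (sampledOp w T u) - ‖u‖ ^ 2 := by
      rw [LinearMap.sub_apply, inner_sub_right, LinearMap.smul_apply, inner_smul_right]
      simp
    have hpi : p⁻¹ * p = 1 := inv_mul_cancel₀ hp0.ne'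
    have h1'' := mul_le_mul_of_nonneg_left h1' (inv_pos.2 hp0).le
    have h2'' := mul_le_mul_of_nonneg_left h2' (inv_pos.2 hp0).le
    have e1 : p⁻¹ * (3 / 2 * p * ‖u‖ ^ 2) = 3 / 2 * ‖u‖ ^ 2 := by
      linear_combination 3 / 2 * ‖u‖ ^ 2 * hpi
    have e2 : p⁻¹ * (1 / 2 * p * ‖u‖ ^ 2) = 1 / 2 * ‖u‖ ^ 2 := by
      linear_combination 1 / 2 * ‖u‖ ^ 2 * hpi
    rw [e, abs_le]
    constructor <;> linarith
  have hb₁ : (B₁.card : ℝ) ≤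
      (Fintype.card κ).choose m * Module.finrank ℝ E * Real.exp (-(4 * l)) := by
    refine le_mul_exp_of_mul_exp_le (card_tail_mul_exp_le hw hR0 hR hN (2 / 5 / R) (3 / 2 * p) m hm
      B₁ ((Finset.filter_subset _ _).trans hB) fun T hT => (Finset.mem_filter.1 hT).2) hc ?_
    have e : (m : ℝ) * ((Real.exp (R * (2 / 5 / R)) - 1) / R / N) - 2 / 5 / R * (3 / 2 * p) =
        p / R * (Real.exp (2 / 5) - 1.6) := by
      rw [mul_div_cancel₀ _ hR0.ne', hp]; field_simp; ring
    rw [← hNdef, e]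
    have hpR : 0 ≤ p / R := by positivity
    nlinarith [exp_two_fifths_le]
  have hb₂ : (B₂.card : ℝ) ≤
      (Fintype.card κ).choose m * Module.finrank ℝ E * Real.exp (-(4 * l)) := by
    refine le_mul_exp_of_mul_exp_le (card_tail_mul_exp_le hw hR0 hR hN (-(1 / 2) / R) (1 / 2 * p) m
      hm B₂ ((Finset.filter_subset _ _).trans hB) fun T hT => (Finset.mem_filter.1 hT).2) hc ?_
    have e : (m : ℝ) * ((Real.exp (R * (-(1 / 2) / R)) - 1) / R / N) - -(1 / 2) / R * (1 / 2 * p) =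
        p / R * (Real.exp (-(1 / 2)) - 0.75) := by
      rw [mul_div_cancel₀ _ hR0.ne', hp]; field_simp; ring
    rw [← hNdef, e]
    have hpR : 0 ≤ p / R := by positivity
    nlinarith [exp_neg_half_le]
  have hcard : (B.card : ℝ) ≤ B₁.card + B₂.card := by
    exact_mod_cast (Finset.card_le_card hcover).trans (Finset.card_union_le _ _)
  linarith

end Sampling

section Frobenius

variable {a b k q : ℕ}

lemma frobenius_sq (X : Matrix (Fin a) (Fin b) ℝ) : ‖X‖ ^ 2 = ∑ i, ∑ j, X i j ^ 2 := by
  rw [frobenius_norm_def, ← Real.sqrt_eq_rpow, Real.sq_sqrt (by positivity)]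
  simp

lemma frobenius_sq_eq_trace (X : Matrix (Fin a) (Fin b) ℝ) : ‖X‖ ^ 2 = (Xᵀ * X).trace := by
  rw [frobenius_sq, Finset.sum_comm]
  simp [Matrix.trace, Matrix.mul_apply, sq]

lemma frobenius_sq_add (X Y : Matrix (Fin a) (Fin b) ℝ) :
    ‖X + Y‖ ^ 2 = ‖X‖ ^ 2 + 2 * (Xᵀ * Y).trace + ‖Y‖ ^ 2 := by
  have h : (Yᵀ * X).trace = (Xᵀ * Y).trace := by
    rw [← Matrix.trace_transpose, Matrix.transpose_mul, Matrix.transpose_transpose]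
  simp only [frobenius_sq_eq_trace, Matrix.transpose_add, Matrix.add_mul, Matrix.mul_add,
    Matrix.trace_add, h]
  ring

lemma norm_isometry_mul {A : Matrix (Fin a) (Fin k) ℝ} (hA : Aᵀ * A = 1)
    (X : Matrix (Fin k) (Fin b) ℝ) : ‖A * X‖ = ‖X‖ := by
  rw [← sq_eq_sq₀ (norm_nonneg _) (norm_nonneg _), frobenius_sq_eq_trace, frobenius_sq_eq_trace,
    Matrix.transpose_mul, Matrix.mul_assoc, ← Matrix.mul_assoc Aᵀ, hA, Matrix.one_mul]

lemma norm_mul_isometry_transpose {B : Matrix (Fin b) (Fin k) ℝ} (hB : Bᵀ * B = 1)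
    (X : Matrix (Fin a) (Fin k) ℝ) : ‖X * Bᵀ‖ = ‖X‖ := by
  rw [← frobenius_norm_transpose, Matrix.transpose_mul, Matrix.transpose_transpose,
    norm_isometry_mul hB, frobenius_norm_transpose]

/-- The square norm of `H diag(s) Vᵀ` in terms of the columns of `H`. -/
lemma norm_sq_mul_svd {V : Matrix (Fin b) (Fin q) ℝ} (hV : Vᵀ * V = 1)
    (H : Matrix (Fin a) (Fin q) ℝ) (s : Fin q → ℝ) :
    ‖H * diagonal s * Vᵀ‖ ^ 2 = ∑ i, s i ^ 2 * ∑ l, H l i ^ 2 := by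
  rw [norm_mul_isometry_transpose hV, frobenius_sq, Finset.sum_comm]
  refine Finset.sum_congr rfl fun i _ => ?_
  rw [Finset.mul_sum]
  refine Finset.sum_congr rfl fun l _ => ?_
  rw [Matrix.mul_diagonal]
  ring

end Frobenius

section TruncatedSVD

variable {a b k q : ℕ}

lemma norm_sq_projection_add {Q : Matrix (Fin a) (Fin k) ℝ} (hQ : Qᵀ * Q = 1)
    (Y : Matrix (Fin a) (Fin b) ℝ) :
    ‖Q * (Qᵀ * Y)‖ ^ 2 + ‖Y - Q * (Qᵀ * Y)‖ ^ 2 = ‖Y‖ ^ 2 := by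
  have h := frobenius_sq_add (Q * (Qᵀ * Y)) (Y - Q * (Qᵀ * Y))
  have h0 : (Q * (Qᵀ * Y))ᵀ * (Y - Q * (Qᵀ * Y)) = 0 := by
    rw [Matrix.transpose_mul, Matrix.mul_assoc, Matrix.mul_sub, ← Matrix.mul_assoc Qᵀ Q, hQ,
      Matrix.one_mul, sub_self, Matrix.mul_zero]
  rw [h0, add_sub_cancel] at h
  simp at h
  linarith

/-- The part of the discarded terms inside a `k`-dimensional space is at most the part of the kept
terms outside it. -/
lemma norm_projection_tail_le {r : ℕ} (hkr : k ≤ r) {Q : Matrix (Fin a) (Fin k) ℝ}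
    (hQ : Qᵀ * Q = 1) {U : Matrix (Fin a) (Fin q) ℝ} (hU : Uᵀ * U = 1)
    {V : Matrix (Fin b) (Fin q) ℝ} (hV : Vᵀ * V = 1) {s : Fin q → ℝ} (hs0 : ∀ i, 0 ≤ s i)
    (hs : Antitone s) :
    ‖Q * (Qᵀ * (U * diagonal (fun i : Fin q => if (i : ℕ) < r then 0 else s i) * Vᵀ))‖ ≤
      ‖U * diagonal (fun i : Fin q => if (i : ℕ) < r then s i else 0) * Vᵀ -
        Q * (Qᵀ * (U * diagonal (fun i : Fin q => if (i : ℕ) < r then s i else 0) * Vᵀ))‖ := by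
  rw [← sq_le_sq₀ (norm_nonneg _) (norm_nonneg _)]
  set t : Fin q → ℝ := fun i => ∑ l, (Qᵀ * U) l i ^ 2 with ht
  have ht0 : ∀ i, 0 ≤ t i := fun i => Finset.sum_nonneg fun l _ => sq_nonneg _
  have hUi : ∀ i, ∑ l, U l i ^ 2 = 1 := by
    intro i
    have := congrFun (congrFun hU i) i
    simpa [Matrix.mul_apply, sq] using this
  have hbound : ∀ (s' : Fin q → ℝ), ‖Q * (Qᵀ * (U * diagonal s' * Vᵀ))‖ ^ 2 =
      ∑ i, s' i ^ 2 * t i := by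
    intro s'
    rw [norm_isometry_mul hQ, ← Matrix.mul_assoc, ← Matrix.mul_assoc, norm_sq_mul_svd hV]
  have hfull : ∀ (s' : Fin q → ℝ), ‖U * diagonal s' * Vᵀ‖ ^ 2 = ∑ i, s' i ^ 2 := by
    intro s'
    rw [norm_sq_mul_svd hV]
    simp [hUi]
  have hcompl : ∀ (s' : Fin q → ℝ),
      ‖U * diagonal s' * Vᵀ - Q * (Qᵀ * (U * diagonal s' * Vᵀ))‖ ^ 2 =
      ∑ i, s' i ^ 2 * (1 - t i) := by
    intro s'
    have := norm_sq_projection_add hQ (U * diagonal s' * Vᵀ)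
    rw [hbound, hfull] at this
    simp only [mul_sub, mul_one, Finset.sum_sub_distrib]
    linarith
  have ht1 : ∀ i, t i ≤ 1 := by
    intro i
    have h := hcompl (fun j => if j = i then 1 else 0)
    have h2 := sq_nonneg ‖U * diagonal (fun j => if j = i then (1 : ℝ) else 0) * Vᵀ -
      Q * (Qᵀ * (U * diagonal (fun j => if j = i then (1 : ℝ) else 0) * Vᵀ))‖
    rw [h] at h2
    simp at h2
    exact h2
  have htsum : ∑ i, t i ≤ k := by
    have h1 : ∑ i, t i = ‖U * (Uᵀ * Q)‖ ^ 2 := by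
      rw [norm_isometry_mul hU, frobenius_sq]
      refine Finset.sum_congr rfl fun i _ => Finset.sum_congr rfl fun l _ => ?_
      congr 1
      rw [Matrix.mul_apply, Matrix.mul_apply]
      exact Finset.sum_congr rfl fun _ _ => mul_comm _ _
    have h2 := norm_sq_projection_add hU Q
    have h3 : ‖Q‖ ^ 2 = k := by rw [frobenius_sq_eq_trace, hQ]; simp
    rw [h1]
    nlinarith [sq_nonneg ‖Q - U * (Uᵀ * Q)‖]
  rw [hbound, hcompl]
  rcases le_or_gt q r with hqr | hqr
  · have h0 : ∑ i : Fin q, (if (i : ℕ) < r then 0 else s i) ^ 2 * t i = 0 := by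
      refine Finset.sum_eq_zero fun i _ => ?_
      simp [i.2.trans_le hqr]
    rw [h0]
    exact Finset.sum_nonneg fun i _ => mul_nonneg (sq_nonneg _) (sub_nonneg.2 (ht1 i))
  · set σ := s ⟨r, hqr⟩ with hσ
    have hcount : ∑ i : Fin q, (if (i : ℕ) < r then (1 : ℝ) else 0) = r := by
      rw [Fin.sum_univ_eq_sum_range (fun i => if i < r then (1 : ℝ) else 0), ← Finset.sum_filter]
      have : (Finset.range q).filter (fun i => i < r) = Finset.range r := by
        ext i; simp; omega
      simp [this]
    have hpt : ∀ i : Fin q, (if (i : ℕ) < r then 0 else s i) ^ 2 * t i ≤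
        (if (i : ℕ) < r then s i else 0) ^ 2 * (1 - t i) +
          σ ^ 2 * (t i - if (i : ℕ) < r then (1 : ℝ) else 0) := by
      intro i
      split_ifs with hi
      · have h1 : σ ≤ s i := hs (by rw [Fin.le_def]; exact hi.le)
        have h2 : σ ^ 2 ≤ s i ^ 2 := pow_le_pow_left₀ (hs0 _) h1 2
        nlinarith [ht1 i]
      · have h1 : s i ≤ σ := hs (by rw [Fin.le_def]; exact not_lt.1 hi)
        have h2 : s i ^ 2 ≤ σ ^ 2 := pow_le_pow_left₀ (hs0 _) h1 2
        nlinarith [ht0 i]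
    refine (Finset.sum_le_sum fun i _ => hpt i).trans ?_
    rw [Finset.sum_add_distrib, ← Finset.mul_sum, Finset.sum_sub_distrib, hcount]
    have hkr' : (k : ℝ) ≤ r := by exact_mod_cast hkr
    nlinarith [sq_nonneg σ]

lemma finrank_range_toEuclideanLin (N : Matrix (Fin a) (Fin b) ℝ) :
    Module.finrank ℝ (LinearMap.range (Matrix.toEuclideanLin N)) = N.rank := by
  rw [Matrix.rank_eq_finrank_range_toLin N (EuclideanSpace.basisFun (Fin a) ℝ).toBasis
      (EuclideanSpace.basisFun (Fin b) ℝ).toBasis, Matrix.toEuclideanLin_eq_toLin_orthonormal]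

lemma exists_isometry_mul_transpose_mul (N : Matrix (Fin a) (Fin b) ℝ) :
    ∃ Q : Matrix (Fin a) (Fin N.rank) ℝ, Qᵀ * Q = 1 ∧ Q * (Qᵀ * N) = N := by
  let β := (stdOrthonormalBasis ℝ (LinearMap.range (Matrix.toEuclideanLin N))).reindex
    (finCongr (finrank_range_toEuclideanLin N))
  refine ⟨Matrix.of fun i l => (β l : EuclideanSpace ℝ (Fin a)) i, ?_, ?_⟩
  · ext l l'
    have h := orthonormal_iff_ite.1 β.orthonormal l l'
    rw [Submodule.coe_inner, PiLp.inner_apply] at h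
    simp only [RCLike.inner_apply, conj_trivial] at h
    rw [Matrix.mul_apply, Matrix.one_apply, ← h]
    exact Finset.sum_congr rfl fun _ _ => by simp [mul_comm]
  · ext i j
    let x : LinearMap.range (Matrix.toEuclideanLin N) :=
      ⟨Matrix.toEuclideanLin N (EuclideanSpace.single j 1), LinearMap.mem_range_self _ _⟩
    have hx : ∀ i, (x : EuclideanSpace ℝ (Fin a)) i = N i j := by
      intro i
      simp [x, Matrix.toLpLin_apply]
    have h := congrArg (fun y : LinearMap.range (Matrix.toEuclideanLin N) =>
      (y : EuclideanSpace ℝ (Fin a)) i) (β.sum_repr' x)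
    simp only [hx] at h
    rw [← h, Matrix.mul_apply]
    simp only [Submodule.coe_sum, Submodule.coe_smul, WithLp.ofLp_sum, Finset.sum_apply,
      PiLp.smul_apply, smul_eq_mul, Matrix.of_apply]
    refine Finset.sum_congr rfl fun l _ => ?_
    rw [mul_comm, Submodule.coe_inner, PiLp.inner_apply, Matrix.mul_apply]
    congr 1
    refine Finset.sum_congr rfl fun i' _ => ?_
    simp [hx, mul_comm]

/-- Truncation to rank `r` increases the distance to a matrix of rank at most `r` by at most the
golden ratio (here rounded up to `1.62`). -/
lemma IsTruncatedSVD.norm_sub_le_mul {r : ℕ} {W Z N : Matrix (Fin a) (Fin b) ℝ}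
    (h : IsTruncatedSVD r W Z) (hN : N.rank ≤ r) : ‖Z - N‖ ≤ 1.62 * ‖W - N‖ := by
  obtain ⟨U, s, V, hW, hZ⟩ := h
  obtain ⟨Q, hQ, hQN⟩ := exists_isometry_mul_transpose_mul N
  set T := U * diagonal (fun i : Fin (min a b) => if (i : ℕ) < r then 0 else s i) * Vᵀ with hT
  have hWZ : W = Z + T := by
    rw [hW.eq, hZ, hT, ← Matrix.add_mul, ← Matrix.mul_add, Matrix.diagonal_add]
    congr 3
    ext i
    split_ifs <;> simp
  have htail := norm_projection_tail_le hN hQ hW.left_orthonormal hW.right_orthonormal hW.nonneg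
    hW.antitone
  rw [← hZ, ← hT] at htail
  have hU0 : ∀ G : Matrix (Fin a) (Fin a) ℝ, ‖G * Z‖ ≤ ‖G * W‖ := by
    intro G
    rw [← sq_le_sq₀ (norm_nonneg _) (norm_nonneg _), hW.eq, hZ, ← Matrix.mul_assoc,
      ← Matrix.mul_assoc, ← Matrix.mul_assoc, ← Matrix.mul_assoc,
      norm_sq_mul_svd hW.right_orthonormal, norm_sq_mul_svd hW.right_orthonormal]
    refine Finset.sum_le_sum fun i _ => mul_le_mul_of_nonneg_right ?_
      (Finset.sum_nonneg fun _ _ => sq_nonneg _)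
    split_ifs
    · exact le_rfl
    · simpa using sq_nonneg (s i)
  have hout : ‖Z - Q * (Qᵀ * Z)‖ ≤ ‖W - Q * (Qᵀ * W)‖ := by
    have := hU0 (1 - Q * Qᵀ)
    simpa [Matrix.sub_mul, Matrix.mul_assoc] using this
  have hp1 := norm_sq_projection_add hQ (Z - N)
  have hp2 := norm_sq_projection_add hQ (W - N)
  have ec : ∀ Y, Y - N - Q * (Qᵀ * (Y - N)) = Y - Q * (Qᵀ * Y) := by
    intro Y
    rw [Matrix.mul_sub, Matrix.mul_sub, hQN]
    abel
  rw [ec] at hp1 hp2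
  have htri : ‖Q * (Qᵀ * (Z - N))‖ ≤ ‖Q * (Qᵀ * (W - N))‖ + ‖Q * (Qᵀ * T)‖ := by
    have e : Q * (Qᵀ * (Z - N)) = Q * (Qᵀ * (W - N)) - Q * (Qᵀ * T) := by
      rw [hWZ, ← Matrix.mul_sub, ← Matrix.mul_sub]
      congr 2
      abel
    rw [e]
    exact _root_.norm_sub_le _ _
  rw [← sq_le_sq₀ (norm_nonneg _) (by positivity), mul_pow, ← hp1, ← hp2]
  set β := ‖Z - Q * (Qᵀ * Z)‖
  set g := ‖Q * (Qᵀ * (W - N))‖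
  have hβ : 0 ≤ β := norm_nonneg _
  have h1 : ‖Q * (Qᵀ * (Z - N))‖ ^ 2 ≤ (g + β) ^ 2 :=
    pow_le_pow_left₀ (norm_nonneg _) (htri.trans (by linarith)) 2
  have h2 : β ^ 2 ≤ ‖W - Q * (Qᵀ * W)‖ ^ 2 := pow_le_pow_left₀ hβ hout 2
  nlinarith [sq_nonneg (g - 0.62 * β)]

end TruncatedSVD

section Target

variable {n₁ n₂ d₁ d₂ : ℕ}

lemma norm_le_sqrt_rank_mul_sigma (X : Matrix (Fin n₁) (Fin n₂) ℝ) :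
    ‖X‖ ≤ Real.sqrt X.rank * sigma X 1 := by
  set T := Matrix.toEuclideanLin X with hT
  have hn : Module.finrank ℝ (EuclideanSpace ℝ (Fin n₂)) = n₂ := by simp
  have hpos : 0 ≤ sigma X 1 := T.singularValues_nonneg _
  have h1 : ∑ i : Fin n₂, T.singularValues i ^ 2 = ‖X‖ ^ 2 := by
    have hsym := T.isSymmetric_adjoint_comp_self
    have e : ∀ i : Fin n₂, T.singularValues i ^ 2 =
        ∑ k, inner ℝ (hsym.eigenvectorBasis hn i) (WithLp.toLp 2 (X k)) ^ 2 := by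
      intro i
      have h2 : T.singularValues i ^ 2 = ‖T (hsym.eigenvectorBasis hn i)‖ ^ 2 := by
        rw [T.sq_singularValues_fin hn, ← real_inner_self_eq_norm_sq,
          ← LinearMap.adjoint_inner_right, ← LinearMap.comp_apply, hsym.apply_eigenvectorBasis,
          inner_smul_right]
        simp
      rw [h2, EuclideanSpace.norm_sq_eq]
      refine Finset.sum_congr rfl fun k _ => ?_
      have h3 : ∀ v, T v k = inner ℝ v (WithLp.toLp 2 (X k)) := by
        intro v
        rw [hT, Matrix.toLpLin_apply, PiLp.inner_apply]
        simp [Matrix.mulVec, dotProduct]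
      rw [Real.norm_eq_abs, sq_abs, h3]
    simp_rw [e]
    rw [Finset.sum_comm, frobenius_sq]
    refine Finset.sum_congr rfl fun k _ => ?_
    rw [sum_sq_inner_left, EuclideanSpace.norm_sq_eq]
    simp
  have hrn : X.rank ≤ n₂ := by simpa using X.rank_le_width
  have h2 : ∑ i : Fin n₂, T.singularValues i ^ 2 ≤ X.rank * sigma X 1 ^ 2 := by
    rw [Fin.sum_univ_eq_sum_range (fun i => T.singularValues i ^ 2),
      ← Finset.sum_subset (Finset.range_subset_range.2 hrn)]
    · refine (Finset.sum_le_card_nsmul _ _ (sigma X 1 ^ 2) fun i _ => ?_).trans (by simp)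
      exact pow_le_pow_left₀ (T.singularValues_nonneg _)
        (T.singularValues_antitone (Nat.zero_le _)) 2
    · intro i _ hi
      rw [Finset.mem_range, not_lt, ← finrank_range_toEuclideanLin] at hi
      rw [(LinearMap.singularValues_eq_zero_iff_le_finrank_range T).2 hi]
      simp
  rw [← sq_le_sq₀ (norm_nonneg _) (by positivity), mul_pow, Real.sq_sqrt (by positivity), ← h1]
  exact h2

lemma sigma_pos (X : Matrix (Fin n₁) (Fin n₂) ℝ) {i : ℕ} (hi : 1 ≤ i) (hr : i ≤ X.rank) :
    0 < sigma X i := by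
  refine (LinearMap.singularValues_pos_iff_lt_finrank_range _).2 ?_
  rw [finrank_range_toEuclideanLin]
  omega

lemma mul_transpose_mul_of_col_mem {a b k : ℕ} {X : Matrix (Fin a) (Fin b) ℝ}
    {A : Matrix (Fin a) (Fin k) ℝ} (hA : Aᵀ * A = 1)
    (h : ∀ j, X.col j ∈ Submodule.span ℝ (Set.range A.col)) : A * (Aᵀ * X) = X := by
  ext i j
  have hj := h j
  rw [← Matrix.range_mulVecLin] at hj
  obtain ⟨c, hc⟩ := hj
  have e : (A * (Aᵀ * X)) i j = (A *ᵥ (Aᵀ *ᵥ X.col j)) i := by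
    simp [Matrix.mul_apply, Matrix.mulVec, dotProduct]
  rw [e, ← hc, Matrix.mulVecLin_apply, Matrix.mulVec_mulVec c Aᵀ A, hA, Matrix.one_mulVec]
  exact congrFun hc i

lemma HasSideInformation.eq_mul {X : Matrix (Fin n₁) (Fin n₂) ℝ} {A : Matrix (Fin n₁) (Fin d₁) ℝ}
    {B : Matrix (Fin n₂) (Fin d₂) ℝ} (h : HasSideInformation X A B) (hA : Aᵀ * A = 1)
    (hB : Bᵀ * B = 1) : A * (Aᵀ * X * B) * Bᵀ = X := by
  have h1 := mul_transpose_mul_of_col_mem hA h.1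
  have h2 := congrArg Matrix.transpose (mul_transpose_mul_of_col_mem (X := Xᵀ) hB h.2)
  simp only [Matrix.transpose_mul, Matrix.transpose_transpose] at h2
  have e : A * (Aᵀ * X * B) * Bᵀ = A * (Aᵀ * (X * B * Bᵀ)) := by simp only [Matrix.mul_assoc]
  rw [e, h2, h1]

end Target

section Gradient

variable {n₁ n₂ d₁ d₂ : ℕ}

/-- The normal operator of sampling, rescaled, deviates from the identity by at most `1/2`. -/
def HasSampledIsometry (A : Matrix (Fin n₁) (Fin d₁) ℝ) (B : Matrix (Fin n₂) (Fin d₂) ℝ)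
    (Ω : Finset (Fin n₁ × Fin n₂)) : Prop :=
  ∀ D : Matrix (Fin d₁) (Fin d₂) ℝ,
    ‖(samplingRate Ω)⁻¹ • (Aᵀ * sampleOp Ω (A * D * Bᵀ) * B) - D‖ ≤ 1 / 2 * ‖D‖

lemma sampleOp_sub (Ω : Finset (Fin n₁ × Fin n₂)) (X Y : Matrix (Fin n₁) (Fin n₂) ℝ) :
    sampleOp Ω X - sampleOp Ω Y = sampleOp Ω (X - Y) := by
  ext i j
  simp only [sampleOp, Matrix.sub_apply, Matrix.of_apply]
  split_ifs <;> simp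

lemma IsProjectedGradientDescent.norm_sub_le_pow {A : Matrix (Fin n₁) (Fin d₁) ℝ}
    {B : Matrix (Fin n₂) (Fin d₂) ℝ} {Ω : Finset (Fin n₁ × Fin n₂)} {r : ℕ}
    {M : ℕ → Matrix (Fin d₁) (Fin d₂) ℝ} {N : Matrix (Fin d₁) (Fin d₂) ℝ}
    (hM : IsProjectedGradientDescent A B Ω (sampleOp Ω (A * N * Bᵀ)) r M)
    (hΩ : HasSampledIsometry A B Ω) (hN : N.rank ≤ r) (t : ℕ) :
    ‖M t - N‖ ≤ 0.81 ^ t * ‖N‖ := by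
  induction t with
  | zero => simp [hM.1]
  | succ t ih =>
    refine ((hM.2 t).norm_sub_le_mul hN).trans ?_
    have h := hΩ (M t - N)
    have e : M t - Aᵀ * ((samplingRate Ω)⁻¹ • (sampleOp Ω (A * M t * Bᵀ) -
        sampleOp Ω (A * N * Bᵀ))) * B - N =
        -((samplingRate Ω)⁻¹ • (Aᵀ * sampleOp Ω (A * (M t - N) * Bᵀ) * B) - (M t - N)) := by
      rw [sampleOp_sub, Matrix.mul_sub, Matrix.sub_mul, Matrix.mul_smul, Matrix.smul_mul]
      abel
    rw [e, norm_neg]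
    rw [pow_succ]
    linarith

lemma initializationConditions_of_isSVD {r : ℕ} {c : ℝ} (hc : 0 < c)
    {X : Matrix (Fin n₁) (Fin n₂) ℝ}
    {A : Matrix (Fin n₁) (Fin d₁) ℝ} {B : Matrix (Fin n₂) (Fin d₂) ℝ}
    {W : Matrix (Fin d₁) (Fin d₂) ℝ} {U : Matrix (Fin d₁) (Fin r) ℝ} {s : Fin r → ℝ}
    {V : Matrix (Fin d₂) (Fin r) ℝ} (h : IsSVD W U s V)
    (hW : ‖A * W * Bᵀ - X‖ ≤ sigma X r / c) :
    InitializationConditions c X A B (U * Matrix.diagonal fun i => Real.sqrt (s i))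
      (V * Matrix.diagonal fun i => Real.sqrt (s i)) := by
  have hdiag : (Matrix.diagonal fun i => Real.sqrt (s i)) *
      (Matrix.diagonal fun i => Real.sqrt (s i)) = Matrix.diagonal s := by
    rw [Matrix.diagonal_mul_diagonal]
    congr 1
    ext i
    exact Real.mul_self_sqrt (h.nonneg i)
  constructor
  · have e : A * (U * Matrix.diagonal fun i => Real.sqrt (s i)) *
        (V * Matrix.diagonal fun i => Real.sqrt (s i))ᵀ * Bᵀ = A * W * Bᵀ := by
      rw [h.eq, ← hdiag]
      simp only [Matrix.transpose_mul, Matrix.diagonal_transpose, Matrix.mul_assoc]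
    rw [e]
    exact hW
  · have e : ∀ {d : ℕ} (Y : Matrix (Fin d) (Fin r) ℝ), Yᵀ * Y = 1 →
        (Y * Matrix.diagonal fun i => Real.sqrt (s i))ᵀ *
          (Y * Matrix.diagonal fun i => Real.sqrt (s i)) = Matrix.diagonal s := by
      intro d Y hY
      rw [Matrix.transpose_mul, Matrix.diagonal_transpose, Matrix.mul_assoc,
        ← Matrix.mul_assoc Yᵀ, hY, Matrix.one_mul, hdiag]
    rw [e U h.left_orthonormal, e V h.right_orthonormal, sub_self, norm_zero]
    exact div_nonneg (LinearMap.singularValues_nonneg _ _) (by positivity)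

lemma pow_le_inv_of_log_le {x : ℝ} (hx : 0 < x) {t : ℕ} (ht : 5 * Real.log x ≤ t) :
    (0.81 : ℝ) ^ t ≤ x⁻¹ := by
  have h1 : (0.81 : ℝ) ≤ Real.exp (-(1 / 5)) := by
    have h : (0.81 : ℝ) ^ 5 ≤ Real.exp (-(1 / 5)) ^ 5 := by
      rw [← Real.exp_nat_mul]
      have e : Real.exp ((5 : ℕ) * -(1 / 5)) = (Real.exp 1)⁻¹ := by
        rw [← Real.exp_neg]; norm_num
      rw [e, le_inv_comm₀ (by norm_num) (Real.exp_pos 1)]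
      exact Real.exp_one_lt_d9.le.trans (by norm_num)
    exact le_of_pow_le_pow_left₀ (by norm_num) (Real.exp_pos _).le h
  calc (0.81 : ℝ) ^ t ≤ Real.exp (-(1 / 5)) ^ t := pow_le_pow_left₀ (by norm_num) h1 t
    _ = Real.exp (t * -(1 / 5)) := by rw [← Real.exp_nat_mul]
    _ ≤ Real.exp (-Real.log x) := Real.exp_le_exp.2 (by linarith)
    _ = x⁻¹ := by rw [Real.exp_neg, Real.exp_log hx]

lemma initializationConditions_of_hasSampledIsometry {r : ℕ} {c : ℝ} (hr : 1 ≤ r) (hc : 0 < c)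
    {X : Matrix (Fin n₁) (Fin n₂) ℝ} {A : Matrix (Fin n₁) (Fin d₁) ℝ}
    {B : Matrix (Fin n₂) (Fin d₂) ℝ} (hX : X.rank = r) (hA : Aᵀ * A = 1) (hB : Bᵀ * B = 1)
    (hside : HasSideInformation X A B) {Ω : Finset (Fin n₁ × Fin n₂)}
    (hΩ : HasSampledIsometry A B Ω) {M : ℕ → Matrix (Fin d₁) (Fin d₂) ℝ}
    (hM : IsProjectedGradientDescent A B Ω (sampleOp Ω X) r M) {τ : ℕ}
    (hτ : 5 * Real.log (c * Real.sqrt r * conditionNumber X) ≤ τ)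
    {U : Matrix (Fin d₁) (Fin r) ℝ} {s : Fin r → ℝ} {V : Matrix (Fin d₂) (Fin r) ℝ}
    (hsvd : IsSVD (M τ) U s V) :
    InitializationConditions c X A B (U * Matrix.diagonal fun i => Real.sqrt (s i))
      (V * Matrix.diagonal fun i => Real.sqrt (s i)) := by
  refine initializationConditions_of_isSVD hc hsvd ?_
  set N := Aᵀ * X * B with hN
  have hXN : A * N * Bᵀ = X := hside.eq_mul hA hB
  have hrank : N.rank ≤ r := by
    rw [← hX, hN]
    exact (Matrix.rank_mul_le_left _ _).trans (Matrix.rank_mul_le_right _ _)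
  have hnorm : ∀ D : Matrix (Fin d₁) (Fin d₂) ℝ, ‖A * D * Bᵀ‖ = ‖D‖ := fun D => by
    rw [norm_mul_isometry_transpose hB, norm_isometry_mul hA]
  have hpow := IsProjectedGradientDescent.norm_sub_le_pow (by rw [hXN]; exact hM) hΩ hrank τ
  have hσr : 0 < sigma X r := sigma_pos X hr hX.ge
  have hσ1 : 0 < sigma X 1 := sigma_pos X le_rfl (hX ▸ hr)
  have hr0 : 0 < Real.sqrt r := Real.sqrt_pos.2 (by exact_mod_cast hr)
  have hcond : conditionNumber X = sigma X 1 / sigma X r := by rw [conditionNumber, hX]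
  have hx : 0 < c * Real.sqrt r * conditionNumber X := by rw [hcond]; positivity
  have e : A * M τ * Bᵀ - X = A * (M τ - N) * Bᵀ := by
    rw [Matrix.mul_sub, Matrix.sub_mul, hXN]
  rw [e, hnorm]
  calc ‖M τ - N‖ ≤ 0.81 ^ τ * ‖N‖ := hpow
    _ ≤ (c * Real.sqrt r * conditionNumber X)⁻¹ * (Real.sqrt r * sigma X 1) := by
      have h1 := norm_le_sqrt_rank_mul_sigma X
      rw [← hXN, hnorm, hXN, hX] at h1
      exact mul_le_mul (pow_le_inv_of_log_le hx hτ) h1 (norm_nonneg _) (inv_nonneg.2 hx.le)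
    _ = sigma X r / c := by
      rw [hcond]
      field_simp

end Gradient

section Frame

variable {n₁ n₂ d₁ d₂ : ℕ}

/-- The entries of a matrix as a vector of Euclidean space. -/
noncomputable def matrixToVec {a b : ℕ} (M : Matrix (Fin a) (Fin b) ℝ) :
    EuclideanSpace ℝ (Fin a × Fin b) := WithLp.toLp 2 fun x => M x.1 x.2

lemma norm_matrixToVec {a b : ℕ} (M : Matrix (Fin a) (Fin b) ℝ) : ‖matrixToVec M‖ = ‖M‖ := by
  rw [← sq_eq_sq₀ (norm_nonneg _) (norm_nonneg _), frobenius_sq, EuclideanSpace.norm_sq_eq,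
    Fintype.sum_prod_type]
  simp [matrixToVec]

lemma matrixToVec_surjective {a b : ℕ} (v : EuclideanSpace ℝ (Fin a × Fin b)) :
    ∃ M : Matrix (Fin a) (Fin b) ℝ, matrixToVec M = v :=
  ⟨Matrix.of fun i j => v (i, j), rfl⟩

/-- The vector representing the functional `M ↦ (A M Bᵀ)ᵢⱼ`. -/
noncomputable def sampleVec (A : Matrix (Fin n₁) (Fin d₁) ℝ) (B : Matrix (Fin n₂) (Fin d₂) ℝ)
    (e : Fin n₁ × Fin n₂) : EuclideanSpace ℝ (Fin d₁ × Fin d₂) :=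
  matrixToVec (Matrix.of fun k l => A e.1 k * B e.2 l)

lemma inner_sampleVec (A : Matrix (Fin n₁) (Fin d₁) ℝ) (B : Matrix (Fin n₂) (Fin d₂) ℝ)
    (e : Fin n₁ × Fin n₂) (M : Matrix (Fin d₁) (Fin d₂) ℝ) :
    inner ℝ (sampleVec A B e) (matrixToVec M) = (A * M * Bᵀ) e.1 e.2 := by
  rw [PiLp.inner_apply, Fintype.sum_prod_type, Finset.sum_comm, Matrix.mul_apply]
  refine Finset.sum_congr rfl fun l _ => ?_
  rw [Matrix.mul_apply, Finset.sum_mul]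
  refine Finset.sum_congr rfl fun k _ => ?_
  simp [sampleVec, matrixToVec]
  ring

lemma sum_inner_sampleVec_sq {A : Matrix (Fin n₁) (Fin d₁) ℝ} {B : Matrix (Fin n₂) (Fin d₂) ℝ}
    (hA : Aᵀ * A = 1) (hB : Bᵀ * B = 1) (v : EuclideanSpace ℝ (Fin d₁ × Fin d₂)) :
    ∑ e, inner ℝ (sampleVec A B e) v ^ 2 = ‖v‖ ^ 2 := by
  obtain ⟨M, rfl⟩ := matrixToVec_surjective v
  simp_rw [inner_sampleVec]
  rw [norm_matrixToVec, ← norm_isometry_mul hA, ← norm_mul_isometry_transpose hB, frobenius_sq,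
    Fintype.sum_prod_type]

lemma norm_sampleVec_sq (A : Matrix (Fin n₁) (Fin d₁) ℝ) (B : Matrix (Fin n₂) (Fin d₂) ℝ)
    (e : Fin n₁ × Fin n₂) :
    ‖sampleVec A B e‖ ^ 2 = (∑ k, A e.1 k ^ 2) * ∑ l, B e.2 l ^ 2 := by
  rw [sampleVec, norm_matrixToVec, frobenius_sq, Finset.sum_mul_sum]
  simp [mul_pow]

lemma sampledOp_sampleVec (A : Matrix (Fin n₁) (Fin d₁) ℝ) (B : Matrix (Fin n₂) (Fin d₂) ℝ)
    (Ω : Finset (Fin n₁ × Fin n₂)) (M : Matrix (Fin d₁) (Fin d₂) ℝ) :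
    sampledOp (sampleVec A B) Ω (matrixToVec M) =
      matrixToVec (Aᵀ * sampleOp Ω (A * M * Bᵀ) * B) := by
  ext ⟨k, l⟩
  rw [sampledOp_apply]
  simp_rw [inner_sampleVec]
  have e : (matrixToVec (Aᵀ * sampleOp Ω (A * M * Bᵀ) * B)) (k, l) =
      ∑ x : Fin n₁ × Fin n₂, if x ∈ Ω then (A * M * Bᵀ) x.1 x.2 * (A x.1 k * B x.2 l) else 0 := by
    rw [Fintype.sum_prod_type, Finset.sum_comm]
    simp only [matrixToVec, Matrix.mul_apply (N := B)]
    refine Finset.sum_congr rfl fun j _ => ?_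
    rw [Matrix.mul_apply, Finset.sum_mul]
    refine Finset.sum_congr rfl fun i _ => ?_
    simp only [sampleOp, Matrix.of_apply, Matrix.transpose_apply]
    split_ifs <;> ring
  rw [e, ← Finset.sum_filter, Finset.filter_mem_eq_inter, Finset.univ_inter]
  simp [sampleVec, matrixToVec]

lemma hasSampledIsometry_iff (A : Matrix (Fin n₁) (Fin d₁) ℝ) (B : Matrix (Fin n₂) (Fin d₂) ℝ)
    (Ω : Finset (Fin n₁ × Fin n₂)) :
    HasSampledIsometry A B Ω ↔
      ∀ v, ‖(samplingRate Ω)⁻¹ • sampledOp (sampleVec A B) Ω v - v‖ ≤ 1 / 2 * ‖v‖ := by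
  have e : ∀ M : Matrix (Fin d₁) (Fin d₂) ℝ,
      (samplingRate Ω)⁻¹ • sampledOp (sampleVec A B) Ω (matrixToVec M) - matrixToVec M =
        matrixToVec ((samplingRate Ω)⁻¹ • (Aᵀ * sampleOp Ω (A * M * Bᵀ) * B) - M) := by
    intro M
    rw [sampledOp_sampleVec]
    rfl
  constructor
  · intro h v
    obtain ⟨M, rfl⟩ := matrixToVec_surjective v
    rw [e, norm_matrixToVec, norm_matrixToVec]
    exact h M
  · intro h M
    have := h (matrixToVec M)
    rwa [e, norm_matrixToVec, norm_matrixToVec] at this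

lemma IsIncoherent.sum_sq_le {a k : ℕ} {μ : ℝ} {A : Matrix (Fin a) (Fin k) ℝ}
    (h : IsIncoherent μ A) (hμ : 0 ≤ μ) (i : Fin a) : ∑ j, A i j ^ 2 ≤ μ * k / a := by
  have h1 : Real.sqrt (∑ j, A i j ^ 2) ≤ Real.sqrt (μ * k / a) :=
    (le_ciSup (f := fun i : Fin a => Real.sqrt (∑ j, A i j ^ 2)) (Set.finite_range _).bddAbove
      i).trans h
  exact (Real.sqrt_le_sqrt_iff (by positivity)).1 h1

lemma IsIncoherent.pos {a k : ℕ} {μ : ℝ} {A : Matrix (Fin a) (Fin k) ℝ}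
    (h : IsIncoherent μ A) (hA : Aᵀ * A = 1) (hk : 0 < k) : 0 < μ := by
  by_contra hμ
  rw [not_lt] at hμ
  have h0 : A = 0 := by
    ext i j
    have h1 : Real.sqrt (∑ j, A i j ^ 2) ≤ Real.sqrt (μ * k / a) :=
      (le_ciSup (f := fun i : Fin a => Real.sqrt (∑ j, A i j ^ 2)) (Set.finite_range _).bddAbove
        i).trans h
    have h2 : μ * k / a ≤ 0 := div_nonpos_of_nonpos_of_nonneg
      (mul_nonpos_of_nonpos_of_nonneg hμ (Nat.cast_nonneg k)) (Nat.cast_nonneg a)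
    rw [Real.sqrt_eq_zero_of_nonpos h2, Real.sqrt_le_iff] at h1
    have h3 := Finset.single_le_sum (f := fun j => A i j ^ 2) (fun _ _ => sq_nonneg _)
      (Finset.mem_univ j)
    have h4 : A i j ^ 2 = 0 := le_antisymm (by linarith [h1.2]) (sq_nonneg _)
    simpa using h4
  have := congrFun (congrFun hA ⟨0, hk⟩) ⟨0, hk⟩
  simp [h0] at this

lemma le_of_isometry {a k : ℕ} {A : Matrix (Fin a) (Fin k) ℝ} (hA : Aᵀ * A = 1) : k ≤ a := by
  have h1 : (Aᵀ * A).rank = k := by rw [hA]; simp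
  have h2 := (Matrix.rank_mul_le_right Aᵀ A).trans A.rank_le_height
  omega

end Frame

open Classical in
/-- All but a fraction `2 n⁻²` of the sampling sets satisfy the isometry property. -/
lemma card_not_hasSampledIsometry_le {n₁ n₂ d₁ d₂ m : ℕ} {μ : ℝ}
    {A : Matrix (Fin n₁) (Fin d₁) ℝ} {B : Matrix (Fin n₂) (Fin d₂) ℝ}
    (hA : Aᵀ * A = 1) (hB : Bᵀ * B = 1) (hd₁ : 0 < d₁) (hd₂ : 0 < d₂)
    (hAμ : IsIncoherent μ A) (hBμ : IsIncoherent μ B) (hm : m ≤ n₁ * n₂) (hn : 1 < max n₁ n₂)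
    (hsample : 50 * μ ^ 2 * d₁ * d₂ * Real.log (max n₁ n₂ : ℕ) ≤ m) :
    (((Finset.powersetCard m (Finset.univ : Finset (Fin n₁ × Fin n₂))).filter
      fun Ω => ¬ HasSampledIsometry A B Ω).card : ℝ) ≤
      2 / ((max n₁ n₂ : ℕ) : ℝ) ^ 2 * (n₁ * n₂).choose m := by
  have hd₁n := le_of_isometry hA
  have hd₂n := le_of_isometry hB
  have hn₁ : 0 < n₁ := hd₁.trans_le hd₁n
  have hn₂ : 0 < n₂ := hd₂.trans_le hd₂n
  set n : ℝ := ((max n₁ n₂ : ℕ) : ℝ) with hndef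
  have hn1 : 1 < n := by rw [hndef]; exact_mod_cast hn
  have hn0 : 0 < n := by linarith
  have hlog : 0 < Real.log n := Real.log_pos hn1
  have hμ : 0 < μ := hAμ.pos hA hd₁
  have hd₁' : (0 : ℝ) < d₁ := by exact_mod_cast hd₁
  have hd₂' : (0 : ℝ) < d₂ := by exact_mod_cast hd₂
  have hn₁' : (0 : ℝ) < n₁ := by exact_mod_cast hn₁
  have hn₂' : (0 : ℝ) < n₂ := by exact_mod_cast hn₂
  have hcard : Fintype.card (Fin n₁ × Fin n₂) = n₁ * n₂ := by simp
  have hm0 : 0 < m := by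
    have : (0 : ℝ) < m := lt_of_lt_of_le (by positivity) hsample
    exact_mod_cast this
  have hD : (d₁ : ℝ) * d₂ ≤ n ^ 2 := by
    have h1 : (d₁ : ℝ) ≤ n := by
      rw [hndef]; exact_mod_cast hd₁n.trans (le_max_left _ _)
    have h2 : (d₂ : ℝ) ≤ n := by
      rw [hndef]; exact_mod_cast hd₂n.trans (le_max_right _ _)
    rw [sq]
    gcongr
  have key := card_not_near_identity_le (w := sampleVec A B) (R := μ * d₁ / n₁ * (μ * d₂ / n₂))
    (l := Real.log n) (sum_inner_sampleVec_sq hA hB) (by positivity)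
    (fun e => by
      rw [norm_sampleVec_sq]
      exact mul_le_mul (hAμ.sum_sq_le hμ.le _) (hBμ.sum_sq_le hμ.le _)
        (Finset.sum_nonneg fun _ _ => sq_nonneg _) (by positivity))
    (by rw [hcard]; positivity) m hm0 (by rw [hcard]; exact hm)
    (by
      rw [hcard]
      refine le_trans (le_of_eq ?_) hsample
      push_cast
      field_simp)
    ((Finset.powersetCard m (Finset.univ : Finset (Fin n₁ × Fin n₂))).filter
      fun Ω => ¬ HasSampledIsometry A B Ω) (Finset.filter_subset _ _)
    (fun Ω hΩ => by
      rw [Finset.mem_filter, hasSampledIsometry_iff] at hΩ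
      have hrate : samplingRate Ω = (m : ℝ) / Fintype.card (Fin n₁ × Fin n₂) := by
        rw [samplingRate, (Finset.mem_powersetCard.1 hΩ.1).2, hcard]
        push_cast
        rfl
      have h2 := hΩ.2
      rw [hrate] at h2
      push Not at h2
      exact h2)
  refine key.trans ?_
  have hexp : Real.exp (-(4 * Real.log n)) = (n ^ 4)⁻¹ := by
    rw [Real.exp_neg, show (4 : ℝ) * Real.log n = ((4 : ℕ) : ℝ) * Real.log n by norm_num,
      Real.exp_nat_mul, Real.exp_log hn0]
  have hfin : (Module.finrank ℝ (EuclideanSpace ℝ (Fin d₁ × Fin d₂)) : ℝ) = d₁ * d₂ := by simp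
  rw [hexp, hfin, hcard]
  calc 2 * (((n₁ * n₂).choose m : ℝ) * (d₁ * d₂) * (n ^ 4)⁻¹)
      ≤ 2 * (((n₁ * n₂).choose m : ℝ) * n ^ 2 * (n ^ 4)⁻¹) := by gcongr
    _ = 2 / n ^ 2 * (n₁ * n₂).choose m := by field_simp

lemma le_uniformSampling_of_card_compl_le {n₁ n₂ m : ℕ} (hm : m ≤ n₁ * n₂)
    (S : Set (Finset (Fin n₁ × Fin n₂))) (G : Finset (Fin n₁ × Fin n₂) → Prop) [DecidablePred G]
    (hGS : ∀ Ω, G Ω → Ω ∈ S) {ε : ℝ}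
    (hε : (((Finset.powersetCard m (Finset.univ : Finset (Fin n₁ × Fin n₂))).filter
      fun Ω => ¬ G Ω).card : ℝ) ≤ ε * (n₁ * n₂).choose m) :
    ENNReal.ofReal (1 - ε) ≤ (uniformSampling n₁ n₂ m hm).toOuterMeasure S := by
  refine le_trans ?_ (MeasureTheory.measure_mono (s := {Ω | G Ω}) hGS)
  rw [uniformSampling, PMF.toOuterMeasure_uniformOfFinset_apply, Finset.card_powersetCard,
    Finset.card_univ, Fintype.card_prod, Fintype.card_fin, Fintype.card_fin]
  have hpos : 0 < (n₁ * n₂).choose m := Nat.choose_pos hm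
  have hpos' : (0 : ℝ) < (n₁ * n₂).choose m := by exact_mod_cast hpos
  rw [ENNReal.le_div_iff_mul_le (Or.inl (by exact_mod_cast hpos.ne')) (Or.inl (by simp)),
    ← ENNReal.ofReal_natCast, ← ENNReal.ofReal_natCast, ← ENNReal.ofReal_mul' hpos'.le]
  apply ENNReal.ofReal_le_ofReal
  have hsum := Finset.card_filter_add_card_filter_not (s := Finset.powersetCard m
    (Finset.univ : Finset (Fin n₁ × Fin n₂))) (fun Ω => G Ω)
  rw [Finset.card_powersetCard, Finset.card_univ, Fintype.card_prod, Fintype.card_fin,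
    Fintype.card_fin] at hsum
  have hsum' : ((((Finset.powersetCard m (Finset.univ : Finset (Fin n₁ × Fin n₂))).filter
      fun Ω => G Ω).card : ℝ) + ((Finset.powersetCard m
      (Finset.univ : Finset (Fin n₁ × Fin n₂))).filter fun Ω => ¬ G Ω).card) =
      (n₁ * n₂).choose m := by exact_mod_cast hsum
  convert (by linarith : (1 - ε) * ((n₁ * n₂).choose m : ℝ) ≤
    (((Finset.powersetCard m (Finset.univ : Finset (Fin n₁ × Fin n₂))).filter
      fun Ω => G Ω).card : ℝ)) using 3
  ext Ω
  simp

theorem mainTheorem7 (n₁ n₂ d₁ d₂ r m : ℕ) (μ c : ℝ) (hr : 1 ≤ r) (hc : 1 < c)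
    (X : Matrix (Fin n₁) (Fin n₂) ℝ) (A : Matrix (Fin n₁) (Fin d₁) ℝ)
    (B : Matrix (Fin n₂) (Fin d₂) ℝ)
    (hX : X.rank = r)
    (hA : IsIsometryMatrix A) (hB : IsIsometryMatrix B)
    (hside : HasSideInformation X A B)
    (hAμ : IsIncoherent μ A) (hBμ : IsIncoherent μ B)
    (hm : m ≤ n₁ * n₂)
    (hsample : 50 * μ ^ 2 * d₁ * d₂ * Real.log (max n₁ n₂ : ℕ) ≤ m) :
    ENNReal.ofReal (1 - 2 / ((max n₁ n₂ : ℕ) : ℝ) ^ 2) ≤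
      (uniformSampling n₁ n₂ m hm).toOuterMeasure
        {Ω | ∀ M : ℕ → Matrix (Fin d₁) (Fin d₂) ℝ,
          IsProjectedGradientDescent A B Ω (sampleOp Ω X) r M →
          ∀ τ : ℕ, 5 * Real.log (c * Real.sqrt r * conditionNumber X) ≤ τ →
          ∀ (U : Matrix (Fin d₁) (Fin r) ℝ) (s : Fin r → ℝ) (V : Matrix (Fin d₂) (Fin r) ℝ),
          IsSVD (M τ) U s V →
          InitializationConditions c X A B
            (U * Matrix.diagonal fun i => Real.sqrt (s i))
            (V * Matrix.diagonal fun i => Real.sqrt (s i))} := by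
  classical
  have hrN : r ≤ (Aᵀ * X * B).rank := by
    conv_lhs => rw [← hX, ← hside.eq_mul hA hB]
    exact (Matrix.rank_mul_le_left _ _).trans (Matrix.rank_mul_le_right _ _)
  have hd₁ : 0 < d₁ := hr.trans (hrN.trans (Matrix.rank_le_height _))
  have hd₂ : 0 < d₂ := hr.trans (hrN.trans (Matrix.rank_le_width _))
  have hn₁ : 0 < n₁ := hd₁.trans_le (le_of_isometry hA)
  rcases Nat.lt_or_ge 1 (max n₁ n₂) with hn | hn
  · refine le_uniformSampling_of_card_compl_le hm _ (HasSampledIsometry A B) ?_ ?_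
    · intro Ω hΩ M hM τ hτ U s V hsvd
      exact initializationConditions_of_hasSampledIsometry hr (by linarith) hX hA hB hside hΩ hM hτ
        hsvd
    · convert card_not_hasSampledIsometry_le hA hB hd₁ hd₂ hAμ hBμ hm hn hsample
  · have h1 : max n₁ n₂ = 1 := le_antisymm hn (hn₁.trans_le (le_max_left _ _))
    rw [h1, ENNReal.ofReal_of_nonpos (by norm_num)]
    exact zero_le
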